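/- Let $0<\lambda\le\Lambda$ and let $N\ge 2$ be an integer. Let $g:\mathbb{R}\to\mathbb{R}$ satisfy: (g1) $g$ is locally Lipschitz; (g2) $g$ is odd; (g3) $\alpha\in(0,+\infty]$ is such that $g>0$ on $(0,\alpha)$ and $g<0$ on $(\alpha,+\infty)$; (g4) $g$ is differentiable at $0$ and $g'(0)>0$. Put $G(t)=\int_0^t g(s)\,ds$, with $G(+\infty)=\lim_{t\to+\infty}G(t)\in(0,+\infty]$ when $\alpha=+\infty$. For $\xi\in\mathbb{R}$ consider the Cauchy problem $$\theta u''+\frac{N-1}{r}\,\Theta u'+g(u)=0\quad (r>0),\qquad u(0)=\xi,\qquad u'(0)=0,\tag{1}$$ where $\theta=\Lambda$ when $u''(r)\ge0$, $\theta=\lambda$ when $u''(r)<0$, $\Theta=\Lambda$ when $u'(r)\ge0$ and $\Theta=\lambda$ when $u'(r)<0$; this is the equation $\mathcal{M}^+_{\lambda,\Lambda}(D^2u)+g(u)=0$ for radial functions on $\mathbb{R}^N$, where $\mathcal{M}^+_{\lambda,\Lambda}$ is the maximal Pucci operator. A function $u$ on $[0,+\infty)$ is called *oscillating* if it has an unbounded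 sequence of zeros, and *localized* if $u(r)$, $u'(r)$ and $u''(r)$ tend to $0$ as $r\to+\infty$. **Theorem.** For every $\xi\in\mathbb{R}$ problem (1) has a solution $u_\xi\in C^2([0,R_\xi))$, with $R_\xi\in(0,+\infty]$, that is maximal, i.e. cannot be extended as a $C^2$ solution to a larger interval $[0,R')$. Moreover, every such maximal solution has the following properties. (i) If $|\xi|=\alpha\in\mathbb{R}$ or $\xi=0$, then $u_\xi\equiv\xi$. (ii) If $\alpha\in\mathbb{R}$ and $|\xi|>\alpha$, then $|u_\xi|$ is strictly increasing on $[0,R_\xi)$ and $|u_\xi(r)|\to+\infty$ as $r\to R_\xi^-$. (iii) If $0<\xi<\alpha$ and $\Lambda G(\xi)\le\lambda G(\alpha)$, then $R_\xi=+\infty$, and $u_\xi$ is oscillating and localized with $\|u_\xi\|_{L^\infty([0,+\infty))}<\alpha$. (iv) If $-\alpha<\xi<0$, then $R_\xi=+\infty$, and $u_\xi$ is oscillating and localized with $\|u_\xi\|_{L^\infty([0,+\infty))}=-\xi<\alpha$. -/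

import Mathlib

open Set Filter Topology MeasureTheory

noncomputable section

namespace PucciRadial

/-- The half-open interval `[0, R)` of the real line, where `R` may be `⊤`. -/
def dom (R : EReal) : Set ℝ := {r : ℝ | 0 ≤ r ∧ (r : EReal) < R}

/-- First derivative on `[0, R)`; it is one-sided at `0`. -/
def d1 (R : EReal) (u : ℝ → ℝ) : ℝ → ℝ := derivWithin u (dom R)

/-- Second derivative on `[0, R)`; it is one-sided at `0`. -/
def d2 (R : EReal) (u : ℝ → ℝ) : ℝ → ℝ := derivWithin (derivWithin u (dom R)) (dom R)

/-- The coefficient in front of a second-order quantity `s` in the maximal Pucci operator: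
`Lam` when `0 ≤ s`, and `lam` when `s < 0`. -/
def coef (lam Lam s : ℝ) : ℝ := if 0 ≤ s then Lam else lam

/-- `g` is positive on `(0, α)` and negative on `(α, +∞)`, for some given `α ∈ (0, +∞]`. -/
def SignCondition (g : ℝ → ℝ) (α : EReal) : Prop :=
  0 < α ∧ (∀ s : ℝ, 0 < s → (s : EReal) < α → 0 < g s) ∧ (∀ s : ℝ, α < (s : EReal) → g s < 0)

/-- The primitive `G t = ∫₀ᵗ g`. -/
def prim (g : ℝ → ℝ) (t : ℝ) : ℝ := ∫ s in (0 : ℝ)..t, g s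

/-- The value `G α` for an extended real `α > 0`. At `α = +∞` it is the limit of `G t` as
`t → +∞` in `[-∞, +∞]`, written as a `limsup` (the limit exists when `g` is eventually of constant
sign, in particular when `g` is positive on `(0, +∞)`). -/
def primAt (g : ℝ → ℝ) (α : EReal) : EReal :=
  if α = ⊤ then limsup (fun t : ℝ => (prim g t : EReal)) atTop else (prim g α.toReal : EReal)

/-- `u` is a solution of class `C²([0, R))` of the radial Cauchy problem
`θ u'' + (N - 1) / r * Θ u' + g(u) = 0`, `u(0) = ξ`, `u'(0) = 0`
associated with the maximal Pucci operator in dimension `N`. -/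
structure IsSolution (lam Lam : ℝ) (N : ℕ) (g : ℝ → ℝ) (ξ : ℝ) (R : EReal) (u : ℝ → ℝ) :
    Prop where
  pos : 0 < R
  contDiffOn : ContDiffOn ℝ 2 u (dom R)
  init : u 0 = ξ
  init_deriv : d1 R u 0 = 0
  eqn : ∀ r ∈ dom R, 0 < r →
    coef lam Lam (d2 R u r) * d2 R u r
      + ((N : ℝ) - 1) / r * (coef lam Lam (d1 R u r) * d1 R u r) + g (u r) = 0

/-- `u` is a solution on `[0, R)` which cannot be continued, as a solution, to any `[0, R')` with
`R < R'`. -/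
def IsMaximalSolution (lam Lam : ℝ) (N : ℕ) (g : ℝ → ℝ) (ξ : ℝ) (R : EReal) (u : ℝ → ℝ) : Prop :=
  IsSolution lam Lam N g ξ R u ∧
    ∀ (R' : EReal) (v : ℝ → ℝ), IsSolution lam Lam N g ξ R' v → EqOn v u (dom R) → R' ≤ R

/-- `|u|` is strictly increasing on `[0, R)` and tends to `+∞` at `R`. -/
def StrictlyIncreasesToInfty (R : EReal) (u : ℝ → ℝ) : Prop :=
  StrictMonoOn (fun r => |u r|) (dom R) ∧
    ∀ M : ℝ, ∃ a ∈ dom R, ∀ r ∈ dom R, a < r → M < |u r|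

/-- A function on `[0, +∞)` is oscillating if it has an unbounded sequence of zeros. -/
def IsOscillating (u : ℝ → ℝ) : Prop :=
  ∃ z : ℕ → ℝ, (∀ n, 0 ≤ z n ∧ u (z n) = 0) ∧ ¬ BddAbove (range z)

/-- A function on `[0, +∞)` is localized if it tends to `0` at infinity together with its
derivatives up to order two. -/
def IsLocalized (u : ℝ → ℝ) : Prop :=
  Tendsto u atTop (𝓝 0) ∧ Tendsto (d1 ⊤ u) atTop (𝓝 0) ∧ Tendsto (d2 ⊤ u) atTop (𝓝 0)

/-- The norm of `u` in `L^∞([0, +∞))`, as an element of `[0, +∞]`. -/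
def supNorm (u : ℝ → ℝ) : EReal :=
  ((eLpNorm u ⊤ (volume.restrict (Ici (0 : ℝ))) : ENNReal) : EReal)

end PucciRadial

end

/-!
Write `φ s = coef lam Lam s * s`, an increasing piecewise linear map, and `k = N - 1`. Solved for the
second derivative, the equation is `u'' = φ⁻¹ (-(k / r) φ(u') - g(u))`. Everything rests on the
monotonicity of `φ` and `φ⁻¹`. No order between the slopes `lam` and `Lam` is used until the potential
barriers are compared, so that `u ↦ -u` is a symmetry exchanging them.

*Cauchy problem.* The singular term `(k / r) φ(u')` is dissipative (`accel_dissipative`), hence the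
phase-space distance of two solutions grows at a rate independent of `k / r`
(`sq_add_sq_le_of_accel`). This gives uniqueness from `r = 0` on. It also gives existence for bounded
Lipschitz `g`: the solutions that rest at `ξ` until a small time `ε` and then follow the regular
equation converge in `C¹` as `ε → 0`, and the limit satisfies `u'(r) = c r + O(r³)` with
`(1 + k) φ(c) = -g(ξ)`, so it is `C²` at the origin (`exists_sol_of_bounded`). Truncating `g` then
shows that a bounded maximal solution is global, and uniqueness glues all solutions into a maximal one.

*Energy.* With `force = -φ⁻¹ (-g)` and `H` its primitive, the energy `E = u'² / 2 + H(u)` satisfies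
`E' = u' (φ⁻¹(-(k / r) φ(u') - g(u)) - φ⁻¹(-g(u))) ≤ -(c / r) u'²`, whatever the signs of `u`, `u'`
and `u''`. For `0 ≤ s ≤ α` one has `H(s) = G(s) / lam` and `H(-s) = G(s) / Lam`. Since `E` drops
strictly at once when `g(ξ) ≠ 0`, a comparison of barriers confines `u` to a compact subset of
`(-α, α)` in both oscillating cases: `Lam G(ξ) ≤ lam G(α)` makes the barrier on the negative side
high enough if `ξ > 0`, and `lam ≤ Lam` suffices if `ξ < 0`. If `|ξ| > α` the same energy gives
`|u| ≥ |ξ|`, and then `ε r` is a barrier from below for `|u|'` as long as `|u|` is bounded.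

*Oscillation and decay.* On the compact set `s * force s ≥ m s²`. If `u` had no zeros beyond some
radius, `arctan (u' / u)` would decrease at a definite rate (`exists_zero_of_mul_deriv2_le`). The
corrected energy `E + (ε / r) u u'` is dissipated at a rate comparable to `E / r`; as `1 / r` is not
integrable at infinity, `E → 0` (`tendsto_energy_zero`), and `u`, `u'`, `u''` tend to `0`.
-/

namespace PucciRadial

/-! ### The piecewise linear nonlinearity -/

/-- The increasing piecewise linear map `s ↦ coef lam Lam s * s`, with slope `Lam` on the positive
half-line and `lam` on the negative one. No order between the two slopes is assumed, so that the
reflection `s ↦ -s` just exchanges them, and the inverse map is again of this form. -/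
noncomputable def pw (lam Lam s : ℝ) : ℝ := coef lam Lam s * s

lemma pw_of_nonneg {lam Lam s : ℝ} (h : 0 ≤ s) : pw lam Lam s = Lam * s := by
  simp [pw, coef, h]

lemma pw_of_nonpos {lam Lam s : ℝ} (h : s ≤ 0) : pw lam Lam s = lam * s := by
  rcases h.lt_or_eq with h | rfl
  · simp [pw, coef, not_le.mpr h]
  · simp [pw]

@[simp] lemma pw_zero {lam Lam : ℝ} : pw lam Lam 0 = 0 := by simp [pw]

lemma pw_neg {lam Lam : ℝ} (s : ℝ) : pw lam Lam (-s) = -pw Lam lam s := by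
  rcases le_total 0 s with h | h
  · rw [pw_of_nonpos (by linarith), pw_of_nonneg h]; ring
  · rw [pw_of_nonneg (by linarith), pw_of_nonpos h]; ring

lemma pw_neg_of_neg {lam Lam s : ℝ} (hl : 0 < lam) (h : s < 0) : pw lam Lam s < 0 := by
  rw [pw_of_nonpos h.le]; exact mul_neg_of_pos_of_neg hl h

lemma pw_inv_pw {lam Lam : ℝ} (hl : 0 < lam) (hL : 0 < Lam) (s : ℝ) :
    pw lam⁻¹ Lam⁻¹ (pw lam Lam s) = s := by
  rcases le_total 0 s with h | h
  · rw [pw_of_nonneg h, pw_of_nonneg (by positivity)]; field_simp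
  · rw [pw_of_nonpos h, pw_of_nonpos (mul_nonpos_of_nonneg_of_nonpos hl.le h)]; field_simp

lemma pw_pw_inv {lam Lam : ℝ} (hl : 0 < lam) (hL : 0 < Lam) (s : ℝ) :
    pw lam Lam (pw lam⁻¹ Lam⁻¹ s) = s := by
  simpa using pw_inv_pw (inv_pos.mpr hl) (inv_pos.mpr hL) s

lemma min_mul_sub_le_pw_sub {lam Lam s t : ℝ} (h : s ≤ t) :
    min lam Lam * (t - s) ≤ pw lam Lam t - pw lam Lam s := by
  have h1 : min lam Lam ≤ lam := min_le_left _ _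
  have h2 : min lam Lam ≤ Lam := min_le_right _ _
  rcases le_total 0 s with hs | hs
  · rw [pw_of_nonneg hs, pw_of_nonneg (hs.trans h)]; nlinarith
  rcases le_total 0 t with ht | ht
  · rw [pw_of_nonpos hs, pw_of_nonneg ht]; nlinarith
  · rw [pw_of_nonpos hs, pw_of_nonpos ht]; nlinarith

lemma pw_sub_le_max_mul_sub {lam Lam s t : ℝ} (h : s ≤ t) :
    pw lam Lam t - pw lam Lam s ≤ max lam Lam * (t - s) := by
  have h1 : lam ≤ max lam Lam := le_max_left _ _
  have h2 : Lam ≤ max lam Lam := le_max_right _ _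
  rcases le_total 0 s with hs | hs
  · rw [pw_of_nonneg hs, pw_of_nonneg (hs.trans h)]; nlinarith
  rcases le_total 0 t with ht | ht
  · rw [pw_of_nonpos hs, pw_of_nonneg ht]; nlinarith
  · rw [pw_of_nonpos hs, pw_of_nonpos ht]; nlinarith

lemma strictMono_pw {lam Lam : ℝ} (hl : 0 < lam) (hL : 0 < Lam) : StrictMono (pw lam Lam) := by
  intro s t h
  have := min_mul_sub_le_pw_sub (lam := lam) (Lam := Lam) h.le
  have : 0 < min lam Lam * (t - s) := mul_pos (lt_min hl hL) (by linarith)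
  linarith

lemma abs_pw_sub_le {lam Lam : ℝ} (hl : 0 < lam) (hL : 0 < Lam) (s t : ℝ) :
    |pw lam Lam s - pw lam Lam t| ≤ max lam Lam * |s - t| := by
  rcases le_total s t with h | h
  · rw [abs_sub_comm, abs_sub_comm s t, abs_of_nonneg (sub_nonneg.mpr h),
      abs_of_nonneg (sub_nonneg.mpr ((strictMono_pw hl hL).monotone h))]
    exact pw_sub_le_max_mul_sub h
  · rw [abs_of_nonneg (sub_nonneg.mpr h),
      abs_of_nonneg (sub_nonneg.mpr ((strictMono_pw hl hL).monotone h))]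
    exact pw_sub_le_max_mul_sub h

lemma abs_pw_le {lam Lam : ℝ} (hl : 0 < lam) (hL : 0 < Lam) (s : ℝ) :
    |pw lam Lam s| ≤ max lam Lam * |s| := by
  simpa using abs_pw_sub_le hl hL s 0

lemma continuous_pw {lam Lam : ℝ} (hl : 0 < lam) (hL : 0 < Lam) : Continuous (pw lam Lam) := by
  have : LipschitzWith (max lam Lam).toNNReal (pw lam Lam) := by
    refine LipschitzWith.of_dist_le_mul fun s t => ?_
    rw [Real.coe_toNNReal _ (le_max_of_le_left hl.le)]
    exact abs_pw_sub_le hl hL s t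
  exact this.continuous

/-- The second derivative determined by the equation
`φ (u'') + κ * φ (u') + y = 0`, where `φ = pw lam Lam`, `κ = (N - 1) / r`, `u' = p`, `g u = y`. -/
noncomputable def accel (lam Lam κ p y : ℝ) : ℝ := pw lam⁻¹ Lam⁻¹ (-(κ * pw lam Lam p) - y)

lemma accel_eq_iff {lam Lam : ℝ} (hl : 0 < lam) (hL : 0 < Lam) {κ p y q : ℝ} :
    q = accel lam Lam κ p y ↔ pw lam Lam q + κ * pw lam Lam p + y = 0 := by
  constructor
  · rintro rfl
    rw [accel, pw_pw_inv hl hL]; ring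
  · intro h
    rw [accel, show -(κ * pw lam Lam p) - y = pw lam Lam q by linarith, pw_inv_pw hl hL]

lemma accel_neg {lam Lam κ p y : ℝ} : accel lam Lam κ (-p) (-y) = -accel Lam lam κ p y := by
  rw [accel, accel, ← pw_neg, pw_neg]; congr 1; ring

lemma accel_le_accel {lam Lam κ : ℝ} (hl : 0 < lam) (hL : 0 < Lam) (hκ : 0 ≤ κ) {p₁ p₂ y₁ y₂ : ℝ}
    (hp : p₁ ≤ p₂) (hy : y₁ ≤ y₂) : accel lam Lam κ p₂ y₂ ≤ accel lam Lam κ p₁ y₁ := by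
  refine (strictMono_pw (inv_pos.mpr hl) (inv_pos.mpr hL)).monotone ?_
  have := mul_le_mul_of_nonneg_left ((strictMono_pw hl hL).monotone hp) hκ
  linarith

/-- The damping term is dissipative: this is what makes the singular coefficient `κ = (N - 1) / r`
harmless near `r = 0`. -/
lemma accel_dissipative {lam Lam κ : ℝ} (hl : 0 < lam) (hL : 0 < Lam) (hκ : 0 ≤ κ) (p₁ p₂ y : ℝ) :
    (p₁ - p₂) * (accel lam Lam κ p₁ y - accel lam Lam κ p₂ y) ≤ 0 := by
  rcases le_total p₁ p₂ with h | h
  · exact mul_nonpos_of_nonpos_of_nonneg (by linarith)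
      (sub_nonneg.mpr (accel_le_accel hl hL hκ h le_rfl))
  · exact mul_nonpos_of_nonneg_of_nonpos (by linarith)
      (sub_nonpos.mpr (accel_le_accel hl hL hκ h le_rfl))

lemma mul_accel_sub_le {lam Lam κ : ℝ} (hl : 0 < lam) (hL : 0 < Lam) (hκ : 0 ≤ κ) (p y : ℝ) :
    p * (accel lam Lam κ p y - accel lam Lam κ 0 y)
      ≤ -(min lam⁻¹ Lam⁻¹ * min lam Lam * κ * p ^ 2) := by
  have hc : 0 < min lam⁻¹ Lam⁻¹ := lt_min (inv_pos.mpr hl) (inv_pos.mpr hL)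
  simp only [accel, pw_zero, mul_zero, neg_zero, zero_sub]
  rcases le_total 0 p with h | h
  · have h1 := min_mul_sub_le_pw_sub (lam := lam) (Lam := Lam) h
    rw [pw_zero, sub_zero, sub_zero] at h1
    have h2 := mul_le_mul_of_nonneg_left h1 hκ
    have h4 : -(κ * pw lam Lam p) - y ≤ -y := by
      have : 0 ≤ min lam Lam * p := mul_nonneg (lt_min hl hL).le h
      nlinarith
    have h3 := min_mul_sub_le_pw_sub (lam := lam⁻¹) (Lam := Lam⁻¹) h4
    have h5 := mul_le_mul_of_nonneg_left h2 hc.le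
    have h6 : min lam⁻¹ Lam⁻¹ * (κ * (min lam Lam * p)) ≤
      pw lam⁻¹ Lam⁻¹ (-y) - pw lam⁻¹ Lam⁻¹ (-(κ * pw lam Lam p) - y) := by
      refine h5.trans (le_of_eq_of_le ?_ h3); ring
    have := mul_le_mul_of_nonneg_left h6 h
    nlinarith
  · have h1 := min_mul_sub_le_pw_sub (lam := lam) (Lam := Lam) h
    rw [pw_zero, zero_sub, zero_sub] at h1
    have h2 := mul_le_mul_of_nonneg_left h1 hκ
    have h4 : -y ≤ -(κ * pw lam Lam p) - y := by
      have : 0 ≤ min lam Lam * -p := mul_nonneg (lt_min hl hL).le (by linarith)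
      nlinarith
    have h3 := min_mul_sub_le_pw_sub (lam := lam⁻¹) (Lam := Lam⁻¹) h4
    have h5 := mul_le_mul_of_nonneg_left h2 hc.le
    have h6 : min lam⁻¹ Lam⁻¹ * (κ * (min lam Lam * -p)) ≤
      pw lam⁻¹ Lam⁻¹ (-(κ * pw lam Lam p) - y) - pw lam⁻¹ Lam⁻¹ (-y) := by
      refine h5.trans (le_of_eq_of_le ?_ h3); ring
    have := mul_le_mul_of_nonneg_left h6 (neg_nonneg.mpr h)
    nlinarith

lemma abs_accel_sub_le {lam Lam κ : ℝ} (hl : 0 < lam) (hL : 0 < Lam) (hκ : 0 ≤ κ)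
    (p₁ p₂ y₁ y₂ : ℝ) :
    |accel lam Lam κ p₁ y₁ - accel lam Lam κ p₂ y₂|
      ≤ max lam⁻¹ Lam⁻¹ * (κ * (max lam Lam * |p₁ - p₂|) + |y₁ - y₂|) := by
  refine (abs_pw_sub_le (inv_pos.mpr hl) (inv_pos.mpr hL) _ _).trans ?_
  refine mul_le_mul_of_nonneg_left ?_ (le_max_of_le_left (inv_pos.mpr hl).le)
  rw [show -(κ * pw lam Lam p₁) - y₁ - (-(κ * pw lam Lam p₂) - y₂)
    = -(κ * (pw lam Lam p₁ - pw lam Lam p₂)) + -(y₁ - y₂) by ring]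
  refine (abs_add_le _ _).trans ?_
  rw [abs_neg, abs_neg, abs_mul, abs_of_nonneg hκ]
  gcongr
  exact abs_pw_sub_le hl hL _ _

/-- Monotonicity bounds the growth of the speed: `p` and the damping have opposite signs. -/
lemma accel_le_of_nonneg {lam Lam κ : ℝ} (hl : 0 < lam) (hL : 0 < Lam) (hκ : 0 ≤ κ) {p : ℝ}
    (hp : 0 ≤ p) (y : ℝ) : accel lam Lam κ p y ≤ max lam⁻¹ Lam⁻¹ * |y| := by
  refine le_trans ((strictMono_pw (inv_pos.mpr hl) (inv_pos.mpr hL)).monotone (b := -y) ?_) ?_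
  · have : 0 ≤ κ * pw lam Lam p := by rw [pw_of_nonneg hp]; positivity
    linarith
  · simpa using (le_abs_self _).trans (abs_pw_le (inv_pos.mpr hl) (inv_pos.mpr hL) (-y))

lemma le_accel_of_nonpos {lam Lam κ : ℝ} (hl : 0 < lam) (hL : 0 < Lam) (hκ : 0 ≤ κ) {p : ℝ}
    (hp : p ≤ 0) (y : ℝ) : -(max lam⁻¹ Lam⁻¹ * |y|) ≤ accel lam Lam κ p y := by
  have := accel_le_of_nonneg hL hl hκ (neg_nonneg.mpr hp) (-y)
  rw [accel_neg, abs_neg, max_comm] at this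
  linarith

/-! ### Differential inequalities -/

/-- If `f` can grow at rate at most `C` whenever it exceeds `A`, then `f ≤ A + C (x - a)`. -/
lemma le_add_mul_of_deriv_le {f f' : ℝ → ℝ} {a b A C : ℝ} (hab : a ≤ b) (hC : 0 ≤ C)
    (hf : ContinuousOn f (Icc a b)) (hf' : ∀ x ∈ Ioo a b, HasDerivAt f (f' x) x)
    (ha : f a ≤ A) (hle : ∀ x ∈ Ioo a b, A < f x → f' x ≤ C) : f b ≤ A + C * (b - a) := by
  by_contra! hcon
  -- the last point before `b` at which the bound holds
  have hclosed : IsClosed {x ∈ Icc a b | f x ≤ A + C * (x - a)} :=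
    isClosed_Icc.isClosed_le hf (by fun_prop)
  have hcomp : IsCompact {x ∈ Icc a b | f x ≤ A + C * (x - a)} :=
    isCompact_Icc.of_isClosed_subset hclosed fun x hx => hx.1
  obtain ⟨s, ⟨hs, hfs⟩, hmax⟩ := hcomp.exists_isGreatest ⟨a, ⟨le_rfl, hab⟩, by simpa using ha⟩
  have hsb : s < b := by
    rcases hs.2.lt_or_eq with h | rfl
    · exact h
    · linarith
  obtain ⟨x, hx, hslope⟩ := exists_hasDerivAt_eq_slope f f' hsb
    (hf.mono (Icc_subset_Icc_left hs.1)) fun x hx => hf' x ⟨hs.1.trans_lt hx.1, hx.2⟩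
  have hx' : x ∈ Ioo a b := ⟨hs.1.trans_lt hx.1, hx.2⟩
  have hfx : A + C * (x - a) < f x := by
    by_contra! h
    exact absurd (hmax ⟨⟨hx'.1.le, hx'.2.le⟩, h⟩) (not_le.mpr hx.1)
  have := hle x hx' (by nlinarith [hx'.1])
  rw [hslope, div_le_iff₀ (by linarith)] at this
  linarith

lemma abs_le_add_mul_of_deriv {f f' : ℝ → ℝ} {a b A C : ℝ} (hab : a ≤ b) (hC : 0 ≤ C)
    (hf : ContinuousOn f (Icc a b)) (hf' : ∀ x ∈ Ioo a b, HasDerivAt f (f' x) x)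
    (ha : |f a| ≤ A) (hpos : ∀ x ∈ Ioo a b, 0 < f x → f' x ≤ C)
    (hneg : ∀ x ∈ Ioo a b, f x < 0 → -C ≤ f' x) : |f b| ≤ A + C * (b - a) := by
  have hA : 0 ≤ A := (abs_nonneg _).trans ha
  refine abs_le'.mpr ⟨?_, ?_⟩
  · exact le_add_mul_of_deriv_le hab hC hf hf' ((le_abs_self _).trans ha)
      fun x hx h => hpos x hx (hA.trans_lt h)
  · refine le_add_mul_of_deriv_le (f := fun x => -f x) (f' := fun x => -f' x) hab hC hf.neg
      (fun x hx => (hf' x hx).neg) ((neg_le_abs _).trans ha) fun x hx h => ?_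
    have := hneg x hx (by linarith)
    linarith

lemma antitoneOn_Icc_of_hasDerivAt {f f' : ℝ → ℝ} {a b : ℝ}
    (hf : ContinuousOn f (Icc a b)) (hf' : ∀ x ∈ Ioo a b, HasDerivAt f (f' x) x)
    (hle : ∀ x ∈ Ioo a b, f' x ≤ 0) : AntitoneOn f (Icc a b) := by
  refine antitoneOn_of_deriv_nonpos (convex_Icc a b) hf ?_ ?_
  · rw [interior_Icc]
    exact fun x hx => (hf' x hx).differentiableAt.differentiableWithinAt
  · rw [interior_Icc]
    exact fun x hx => by rw [(hf' x hx).deriv]; exact hle x hx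

lemma le_mul_exp_of_deriv_le {f f' : ℝ → ℝ} {a b K : ℝ} (hab : a ≤ b)
    (hf : ContinuousOn f (Icc a b)) (hf' : ∀ x ∈ Ioo a b, HasDerivAt f (f' x) x)
    (hle : ∀ x ∈ Ioo a b, f' x ≤ K * f x) : f b ≤ f a * Real.exp (K * (b - a)) := by
  have h := antitoneOn_Icc_of_hasDerivAt (f := fun x => f x * Real.exp (-(K * (x - a))))
    (f' := fun x => (f' x - K * f x) * Real.exp (-(K * (x - a)))) (a := a) (b := b)
    (hf.mul (by fun_prop)) (fun x hx => by
      have h1 : HasDerivAt (fun x => Real.exp (-(K * (x - a))))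
          (Real.exp (-(K * (x - a))) * (-(K * 1))) x :=
        ((((hasDerivAt_id x).sub_const a).const_mul K).neg).exp
      exact ((hf' x hx).mul h1).congr_deriv (by ring))
    (fun x hx => mul_nonpos_of_nonpos_of_nonneg (by linarith [hle x hx]) (Real.exp_pos _).le)
    ⟨le_rfl, hab⟩ ⟨hab, le_rfl⟩ hab
  simp only [sub_self, mul_zero, neg_zero, Real.exp_zero, mul_one] at h
  rw [Real.exp_neg, ← div_eq_mul_inv, div_le_iff₀ (Real.exp_pos _)] at h
  exact h

/-! ### Solutions as triples -/

lemma dom_coe (T : ℝ) : dom (T : EReal) = Ico 0 T := by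
  ext r; simp [dom]

lemma dom_top : dom ⊤ = Ici 0 := by
  ext r; simp [dom, EReal.coe_lt_top]

lemma dom_mono {R R' : EReal} (h : R ≤ R') : dom R ⊆ dom R' := fun _ hr => ⟨hr.1, hr.2.trans_le h⟩

lemma zero_mem_dom {R : EReal} (h : 0 < R) : (0 : ℝ) ∈ dom R := ⟨le_rfl, by simpa using h⟩

lemma Icc_subset_dom {R : EReal} {r : ℝ} (h : r ∈ dom R) : Icc 0 r ⊆ dom R :=
  fun _ hs => ⟨hs.1, (EReal.coe_le_coe_iff.mpr hs.2).trans_lt h.2⟩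

lemma mem_dom_of_le {R : EReal} {r s : ℝ} (h : r ∈ dom R) (hs : 0 ≤ s) (hsr : s ≤ r) : s ∈ dom R :=
  Icc_subset_dom h ⟨hs, hsr⟩

lemma dom_eq_inter (R : EReal) : dom R = Ici 0 ∩ (Real.toEReal ⁻¹' Iio R) := rfl

lemma isOpen_preimage_Iio (R : EReal) : IsOpen (Real.toEReal ⁻¹' Iio R) :=
  isOpen_Iio.preimage continuous_coe_real_ereal

lemma dom_mem_nhds {R : EReal} {r : ℝ} (h : r ∈ dom R) (h0 : 0 < r) : dom R ∈ 𝓝 r :=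
  inter_mem (Ici_mem_nhds h0) ((isOpen_preimage_Iio R).mem_nhds h.2)

lemma nhdsWithin_dom {R : EReal} {r : ℝ} (h : (r : EReal) < R) : 𝓝[dom R] r = 𝓝[Ici 0] r := by
  rw [dom_eq_inter, nhdsWithin_inter_of_mem' ]
  exact mem_nhdsWithin_of_mem_nhds ((isOpen_preimage_Iio R).mem_nhds h)

/-- On any interval `[0, R)` with `r < R`, differentiability at `r` means the same thing. -/
lemma hasDerivWithinAt_dom_iff {R : EReal} {r : ℝ} (h : (r : EReal) < R) {f : ℝ → ℝ} {f' : ℝ} :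
    HasDerivWithinAt f f' (dom R) r ↔ HasDerivWithinAt f f' (Ici 0) r := by
  rw [HasDerivWithinAt, nhdsWithin_dom h, HasDerivWithinAt]

lemma continuousWithinAt_dom_iff {R : EReal} {r : ℝ} (h : (r : EReal) < R) {f : ℝ → ℝ} :
    ContinuousWithinAt f (dom R) r ↔ ContinuousWithinAt f (Ici 0) r := by
  rw [ContinuousWithinAt, nhdsWithin_dom h, ContinuousWithinAt]

lemma uniqueDiffOn_dom (R : EReal) : UniqueDiffOn ℝ (dom R) := by
  intro r hr
  exact (uniqueDiffWithinAt_congr (nhdsWithin_dom hr.2)).mpr (uniqueDiffOn_Ici (0 : ℝ) r hr.1)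

/-- `u` solves the radial problem on `[0, R)` with first derivative `p` and second derivative `q`,
the equation being solved for `q`. Here `k` stands for `N - 1`. -/
structure Sol (lam Lam k : ℝ) (g : ℝ → ℝ) (ξ : ℝ) (R : EReal) (u p q : ℝ → ℝ) : Prop where
  pos : 0 < R
  hu : ∀ r ∈ dom R, HasDerivWithinAt u (p r) (dom R) r
  hp : ∀ r ∈ dom R, HasDerivWithinAt p (q r) (dom R) r
  hq : ContinuousOn q (dom R)
  u0 : u 0 = ξ
  p0 : p 0 = 0
  eqn : ∀ r ∈ dom R, 0 < r → q r = accel lam Lam (k / r) (p r) (g (u r))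

section
variable {lam Lam k : ℝ} {N : ℕ} {g : ℝ → ℝ} {ξ : ℝ} {R R' : EReal} {u p q : ℝ → ℝ}

lemma IsSolution.sol (hl : 0 < lam) (hL : 0 < Lam) (h : IsSolution lam Lam N g ξ R u) :
    Sol lam Lam (N - 1) g ξ R u (d1 R u) (d2 R u) := by
  have h2 := h.contDiffOn
  rw [show (2 : WithTop ℕ∞) = 1 + 1 by norm_num,
    contDiffOn_succ_iff_derivWithin (uniqueDiffOn_dom R),
    contDiffOn_one_iff_derivWithin (uniqueDiffOn_dom R)] at h2
  exact ⟨h.pos, fun r hr => (h2.1 r hr).hasDerivWithinAt,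
    fun r hr => (h2.2.2.1 r hr).hasDerivWithinAt, h2.2.2.2, h.init, h.init_deriv,
    fun r hr h0 => (accel_eq_iff hl hL).mpr (h.eqn r hr h0)⟩

namespace Sol

lemma d1_eq (h : Sol lam Lam k g ξ R u p q) : EqOn (d1 R u) p (dom R) :=
  fun r hr => (h.hu r hr).derivWithin (uniqueDiffOn_dom R r hr)

lemma d2_eq (h : Sol lam Lam k g ξ R u p q) : EqOn (d2 R u) q (dom R) :=
  fun r hr => ((h.hp r hr).congr h.d1_eq (h.d1_eq hr)).derivWithin (uniqueDiffOn_dom R r hr)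

lemma isSolution (hl : 0 < lam) (hL : 0 < Lam) (h : Sol lam Lam (N - 1) g ξ R u p q) :
    IsSolution lam Lam N g ξ R u where
  pos := h.pos
  contDiffOn := by
    rw [show (2 : WithTop ℕ∞) = 1 + 1 by norm_num,
      contDiffOn_succ_iff_derivWithin (uniqueDiffOn_dom R),
      contDiffOn_one_iff_derivWithin (uniqueDiffOn_dom R)]
    exact ⟨fun r hr => (h.hu r hr).differentiableWithinAt, by simp,
      fun r hr => ((h.hp r hr).congr h.d1_eq (h.d1_eq hr)).differentiableWithinAt,
      h.hq.congr h.d2_eq⟩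
  init := h.u0
  init_deriv := by rw [h.d1_eq (zero_mem_dom h.pos), h.p0]
  eqn r hr h0 := by
    rw [h.d1_eq hr, h.d2_eq hr]
    exact (accel_eq_iff hl hL).mp (h.eqn r hr h0)

lemma mono (h : Sol lam Lam k g ξ R u p q) (h0 : 0 < R') (hle : R' ≤ R) :
    Sol lam Lam k g ξ R' u p q where
  pos := h0
  hu r hr := (h.hu r (dom_mono hle hr)).mono (dom_mono hle)
  hp r hr := (h.hp r (dom_mono hle hr)).mono (dom_mono hle)
  hq := h.hq.mono (dom_mono hle)
  u0 := h.u0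
  p0 := h.p0
  eqn r hr := h.eqn r (dom_mono hle hr)

lemma congr_nonlinearity (h : Sol lam Lam k g ξ R u p q) {g' : ℝ → ℝ}
    (hg : ∀ r ∈ dom R, g (u r) = g' (u r)) : Sol lam Lam k g' ξ R u p q :=
  { h with eqn := fun r hr h0 => by rw [← hg r hr]; exact h.eqn r hr h0 }

/-- Reflection exchanges the maximal and the minimal operator. -/
lemma neg (h : Sol lam Lam k g ξ R u p q) (hg : Function.Odd g) :
    Sol Lam lam k g (-ξ) R (fun r => -u r) (fun r => -p r) (fun r => -q r) where
  pos := h.pos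
  hu r hr := (h.hu r hr).neg
  hp r hr := (h.hp r hr).neg
  hq := h.hq.neg
  u0 := by rw [h.u0]
  p0 := by rw [h.p0, neg_zero]
  eqn r hr h0 := by rw [hg (u r), accel_neg, ← h.eqn r hr h0]

lemma continuousOn_u (h : Sol lam Lam k g ξ R u p q) : ContinuousOn u (dom R) :=
  fun r hr => (h.hu r hr).continuousWithinAt

lemma continuousOn_p (h : Sol lam Lam k g ξ R u p q) : ContinuousOn p (dom R) :=
  fun r hr => (h.hp r hr).continuousWithinAt

lemma hasDerivAt_u (h : Sol lam Lam k g ξ R u p q) {r : ℝ} (hr : r ∈ dom R) (h0 : 0 < r) :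
    HasDerivAt u (p r) r :=
  (h.hu r hr).hasDerivAt (dom_mem_nhds hr h0)

lemma hasDerivAt_p (h : Sol lam Lam k g ξ R u p q) {r : ℝ} (hr : r ∈ dom R) (h0 : 0 < r) :
    HasDerivAt p (q r) r :=
  (h.hp r hr).hasDerivAt (dom_mem_nhds hr h0)

end Sol

/-! ### Continuous dependence and uniqueness -/

lemma exists_abs_sub_le_of_locallyLipschitz (hg : LocallyLipschitz g) (M : ℝ) :
    ∃ L : ℝ, 0 ≤ L ∧ ∀ s ∈ Icc (-M) M, ∀ t ∈ Icc (-M) M, |g s - g t| ≤ L * |s - t| := by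
  obtain ⟨K, hK⟩ := hg.locallyLipschitzOn.exists_lipschitzOnWith_of_compact
    (isCompact_Icc (a := -M) (b := M))
  exact ⟨K, K.2, fun s hs t ht => hK.dist_le_mul s hs t ht⟩

/-- Since the damping is dissipative, the phase-space distance of two solutions grows at most
exponentially, with a rate that does not see the singular coefficient `k / r`. -/
lemma sq_add_sq_le_of_accel (hl : 0 < lam) (hL : 0 < Lam) (hk : 0 ≤ k) {L a b : ℝ} (ha : 0 ≤ a)
    (hab : a ≤ b) {u₁ p₁ u₂ p₂ : ℝ → ℝ}
    (hu₁ : ContinuousOn u₁ (Icc a b)) (hp₁ : ContinuousOn p₁ (Icc a b))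
    (hu₂ : ContinuousOn u₂ (Icc a b)) (hp₂ : ContinuousOn p₂ (Icc a b))
    (hdu₁ : ∀ r ∈ Ioo a b, HasDerivAt u₁ (p₁ r) r)
    (hdp₁ : ∀ r ∈ Ioo a b, HasDerivAt p₁ (accel lam Lam (k / r) (p₁ r) (g (u₁ r))) r)
    (hdu₂ : ∀ r ∈ Ioo a b, HasDerivAt u₂ (p₂ r) r)
    (hdp₂ : ∀ r ∈ Ioo a b, HasDerivAt p₂ (accel lam Lam (k / r) (p₂ r) (g (u₂ r))) r)
    (hg : ∀ r ∈ Ioo a b, |g (u₁ r) - g (u₂ r)| ≤ L * |u₁ r - u₂ r|) :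
    (u₁ b - u₂ b) ^ 2 + (p₁ b - p₂ b) ^ 2 ≤ ((u₁ a - u₂ a) ^ 2 + (p₁ a - p₂ a) ^ 2) *
      Real.exp ((1 + max lam⁻¹ Lam⁻¹ * |L|) * (b - a)) := by
  refine le_mul_exp_of_deriv_le (f := fun r => (u₁ r - u₂ r) ^ 2 + (p₁ r - p₂ r) ^ 2) hab
    (((hu₁.sub hu₂).pow 2).add ((hp₁.sub hp₂).pow 2))
    (fun r hr => (((hdu₁ r hr).sub (hdu₂ r hr)).pow 2).add (((hdp₁ r hr).sub (hdp₂ r hr)).pow 2))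
    fun r hr => ?_
  have hr0 : 0 ≤ k / r := div_nonneg hk (ha.trans hr.1.le)
  have h1 := accel_dissipative hl hL hr0 (p₁ r) (p₂ r) (g (u₁ r))
  have h2 := abs_accel_sub_le hl hL hr0 (p₂ r) (p₂ r) (g (u₁ r)) (g (u₂ r))
  set A := accel lam Lam (k / r) (p₁ r) (g (u₁ r))
  set A' := accel lam Lam (k / r) (p₂ r) (g (u₁ r))
  set B := accel lam Lam (k / r) (p₂ r) (g (u₂ r))
  set w := u₁ r - u₂ r
  set z := p₁ r - p₂ r
  set c := max lam⁻¹ Lam⁻¹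
  have hc : 0 < c := lt_max_of_lt_left (inv_pos.mpr hl)
  have h3 : |A' - B| ≤ c * |L| * |w| := by
    refine h2.trans ?_
    rw [sub_self, abs_zero, mul_zero, mul_zero, zero_add, mul_assoc]
    exact mul_le_mul_of_nonneg_left
      ((hg r hr).trans (mul_le_mul_of_nonneg_right (le_abs_self L) (abs_nonneg _))) hc.le
  have h4 : z * (A' - B) ≤ |z| * (c * |L| * |w|) :=
    (le_abs_self _).trans (by rw [abs_mul]; exact mul_le_mul_of_nonneg_left h3 (abs_nonneg _))
  have h5 : 2 * (|z| * |w|) ≤ w ^ 2 + z ^ 2 := by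
    nlinarith [sq_nonneg (|z| - |w|), sq_abs z, sq_abs w]
  have h6 : 2 * (w * z) ≤ w ^ 2 + z ^ 2 := by nlinarith [sq_nonneg (w - z)]
  have h7 : c * |L| * (2 * (|z| * |w|)) ≤ c * |L| * (w ^ 2 + z ^ 2) :=
    mul_le_mul_of_nonneg_left h5 (by positivity)
  norm_num
  nlinarith

namespace Sol

lemma congr_of_le (hl : 0 < lam) (hL : 0 < Lam) (hk : 0 ≤ k) (hg : LocallyLipschitz g)
    {R₁ R₂ : EReal} {u₁ p₁ q₁ u₂ p₂ q₂ : ℝ → ℝ} (h₁ : Sol lam Lam k g ξ R₁ u₁ p₁ q₁)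
    (h₂ : Sol lam Lam k g ξ R₂ u₂ p₂ q₂) {r : ℝ} (hr₁ : r ∈ dom R₁) (hr₂ : r ∈ dom R₂) :
    u₁ r = u₂ r ∧ p₁ r = p₂ r := by
  have c₁ := h₁.continuousOn_u.mono (Icc_subset_dom hr₁)
  have c₂ := h₂.continuousOn_u.mono (Icc_subset_dom hr₂)
  obtain ⟨M₁, hM₁⟩ := isCompact_Icc.exists_bound_of_continuousOn c₁
  obtain ⟨M₂, hM₂⟩ := isCompact_Icc.exists_bound_of_continuousOn c₂
  obtain ⟨L, -, hLip⟩ := exists_abs_sub_le_of_locallyLipschitz hg (max M₁ M₂)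
  have m₁ : ∀ s ∈ Ioo 0 r, s ∈ dom R₁ := fun s hs => mem_dom_of_le hr₁ hs.1.le hs.2.le
  have m₂ : ∀ s ∈ Ioo 0 r, s ∈ dom R₂ := fun s hs => mem_dom_of_le hr₂ hs.1.le hs.2.le
  have key := sq_add_sq_le_of_accel (g := g) (L := L) hl hL hk le_rfl hr₁.1 c₁
    (h₁.continuousOn_p.mono (Icc_subset_dom hr₁)) c₂
    (h₂.continuousOn_p.mono (Icc_subset_dom hr₂))
    (fun s hs => h₁.hasDerivAt_u (m₁ s hs) hs.1)
    (fun s hs => h₁.eqn s (m₁ s hs) hs.1 ▸ h₁.hasDerivAt_p (m₁ s hs) hs.1)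
    (fun s hs => h₂.hasDerivAt_u (m₂ s hs) hs.1)
    (fun s hs => h₂.eqn s (m₂ s hs) hs.1 ▸ h₂.hasDerivAt_p (m₂ s hs) hs.1)
    (fun s hs => hLip _ (abs_le.mp ((hM₁ s ⟨hs.1.le, hs.2.le⟩).trans (le_max_left _ _))) _
      (abs_le.mp ((hM₂ s ⟨hs.1.le, hs.2.le⟩).trans (le_max_right _ _))))
  rw [h₁.u0, h₂.u0, h₁.p0, h₂.p0] at key
  simp only [sub_self, ne_eq, OfNat.ofNat_ne_zero, not_false_eq_true, zero_pow, add_zero,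
    zero_mul] at key
  constructor <;> nlinarith [sq_nonneg (u₁ r - u₂ r), sq_nonneg (p₁ r - p₂ r)]

/-- Uniqueness for the Cauchy problem, up to the singular point `r = 0`. -/
lemma unique (hl : 0 < lam) (hL : 0 < Lam) (hk : 0 ≤ k) (hg : LocallyLipschitz g)
    {R₁ R₂ : EReal} {u₁ p₁ q₁ u₂ p₂ q₂ : ℝ → ℝ} (h₁ : Sol lam Lam k g ξ R₁ u₁ p₁ q₁)
    (h₂ : Sol lam Lam k g ξ R₂ u₂ p₂ q₂) {r : ℝ} (hr₁ : r ∈ dom R₁) (hr₂ : r ∈ dom R₂) :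
    u₁ r = u₂ r ∧ p₁ r = p₂ r ∧ q₁ r = q₂ r := by
  obtain ⟨e1, e2⟩ := congr_of_le hl hL hk hg h₁ h₂ hr₁ hr₂
  refine ⟨e1, e2, ?_⟩
  rcases le_total R₁ R₂ with hle | hle
  · refine (uniqueDiffOn_dom R₁ r hr₁).eq_deriv _ (h₁.hp r hr₁) ?_
    refine ((h₂.hp r hr₂).mono (dom_mono hle)).congr (fun s hs => ?_) e2
    exact (congr_of_le hl hL hk hg h₁ h₂ hs (dom_mono hle hs)).2
  · refine (uniqueDiffOn_dom R₂ r hr₂).eq_deriv _ ?_ (h₂.hp r hr₂)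
    refine ((h₁.hp r hr₁).mono (dom_mono hle)).congr (fun s hs => ?_) e2.symm
    exact (congr_of_le hl hL hk hg h₁ h₂ (dom_mono hle hs) hs).2.symm

end Sol
end

/-! ### Existence for a bounded Lipschitz nonlinearity -/

/-- Truncation of `x` to the interval `[-P, P]`. -/
noncomputable def clamp (P x : ℝ) : ℝ := max (-P) (min x P)

lemma abs_clamp_sub_le (P x y : ℝ) : |clamp P x - clamp P y| ≤ |x - y| := by
  unfold clamp
  refine (abs_max_sub_max_le_max _ _ _ _).trans (max_le (by simp) ?_)
  refine (abs_min_sub_min_le_max _ _ _ _).trans (max_le le_rfl (by simp))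

lemma clamp_mem {P : ℝ} (hP : 0 ≤ P) (x : ℝ) : clamp P x ∈ Icc (-P) P :=
  ⟨le_max_left _ _, max_le (by linarith) (min_le_right _ _)⟩

lemma clamp_of_mem {P x : ℝ} (h : x ∈ Icc (-P) P) : clamp P x = x := by
  rw [clamp, min_eq_left h.2, max_eq_right h.1]

lemma clamp_nonneg {P x : ℝ} (hP : 0 ≤ P) (h : 0 ≤ x) : 0 ≤ clamp P x :=
  le_max_of_le_right (le_min h hP)

lemma clamp_nonpos {P x : ℝ} (hP : 0 ≤ P) (h : x ≤ 0) : clamp P x ≤ 0 :=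
  max_le (by linarith) ((min_le_left _ _).trans h)

section
variable {lam Lam k : ℝ} {g : ℝ → ℝ}

/-- Solution of the problem which rests at `ξ` up to `r = ε` and starts moving there. The velocity
is truncated in the Picard-Lindelöf theorem, to have a bounded vector field; the dissipativity of
the damping shows that the truncation is never active. -/
lemma exists_delayed_solution (hl : 0 < lam) (hL : 0 < Lam) (hk : 0 ≤ k) {C L : ℝ}
    (hC : ∀ s, |g s| ≤ C) (hL0 : 0 ≤ L) (hLip : ∀ s t, |g s - g t| ≤ L * |s - t|) (ξ : ℝ)
    {ε T : ℝ} (hε : 0 < ε) (hεT : ε < T) :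
    ∃ u p : ℝ → ℝ, (∀ r ≤ ε, u r = ξ ∧ p r = 0) ∧
      ContinuousOn u (Icc ε T) ∧ ContinuousOn p (Icc ε T) ∧
      (∀ r ∈ Ioo ε T, HasDerivAt u (p r) r) ∧
      (∀ r ∈ Ioo ε T, HasDerivAt p (accel lam Lam (k / r) (p r) (g (u r))) r) ∧
      (∀ r ∈ Icc 0 T, |p r| ≤ max lam⁻¹ Lam⁻¹ * C * r) ∧
      ∀ r ∈ Icc 0 T, |u r - ξ| ≤ max lam⁻¹ Lam⁻¹ * C * r * r := by
  set c := max lam⁻¹ Lam⁻¹ with hc_def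
  set M := max lam Lam with hM_def
  have hc : 0 < c := lt_max_of_lt_left (inv_pos.mpr hl)
  have hM : 0 < M := lt_max_of_lt_left hl
  have hC0 : 0 ≤ C := (abs_nonneg _).trans (hC 0)
  have hT : 0 < T := hε.trans hεT
  set P := c * C * T with hP_def
  have hP : 0 ≤ P := by positivity
  have hφ : Continuous (pw lam Lam) := continuous_pw hl hL
  have hψ : Continuous (pw lam⁻¹ Lam⁻¹) := continuous_pw (inv_pos.mpr hl) (inv_pos.mpr hL)
  let F : ℝ → ℝ × ℝ → ℝ × ℝ := fun r x =>
    (clamp P x.2, accel lam Lam (k / r) (clamp P x.2) (g x.1))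
  have hkr : ∀ r ∈ Icc ε T, 0 ≤ k / r ∧ k / r ≤ k / ε := fun r hr =>
    ⟨div_nonneg hk (hε.le.trans hr.1), div_le_div_of_nonneg_left hk hε hr.1⟩
  set K := 1 + c * (k / ε * M + L) with hK_def
  have hkε : 0 ≤ k / ε := by positivity
  have hK : 0 ≤ K := by positivity
  set A := P + c * (k / ε * (M * P) + C) with hA_def
  have hA : 0 ≤ A := by positivity
  have hPL : IsPicardLindelof F (⟨ε, le_rfl, hεT.le⟩ : Icc ε T) ((ξ, 0) : ℝ × ℝ)
      ⟨A * T, by positivity⟩ 0 ⟨A, hA⟩ ⟨K, hK⟩ := by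
    refine ⟨fun r hr => ?_, fun x _ => ?_, fun r hr x _ => ?_, ?_⟩
    · refine (LipschitzWith.of_dist_le_mul fun x y => ?_).lipschitzOnWith
      obtain ⟨k0, k1⟩ := hkr r hr
      have d1 : |x.1 - y.1| ≤ dist x y := le_max_left (dist x.1 y.1) (dist x.2 y.2)
      have d2 : |clamp P x.2 - clamp P y.2| ≤ dist x y :=
        (abs_clamp_sub_le P x.2 y.2).trans (le_max_right (dist x.1 y.1) (dist x.2 y.2))
      have d0 : 0 ≤ dist x y := dist_nonneg
      change max |clamp P x.2 - clamp P y.2| |_| ≤ K * dist x y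
      refine max_le (d2.trans ?_) ((abs_accel_sub_le hl hL k0 _ _ _ _).trans ?_)
      · refine le_mul_of_one_le_left d0 ?_
        have : 0 ≤ c * (k / ε * M + L) := by positivity
        linarith
      · have e1 := (hLip x.1 y.1).trans (mul_le_mul_of_nonneg_left d1 hL0)
        have e2 : k / r * (M * |clamp P x.2 - clamp P y.2|) ≤ k / ε * (M * dist x y) := by
          gcongr
        have := mul_le_mul_of_nonneg_left (add_le_add e2 e1) hc.le
        nlinarith
    · have h0 : ∀ r ∈ Icc ε T, r ≠ 0 := fun r hr => (hε.trans_le hr.1).ne'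
      refine continuousOn_const.prodMk (hψ.comp_continuousOn ?_)
      exact (((continuousOn_const.div continuousOn_id h0).mul continuousOn_const).neg).sub
        continuousOn_const
    · obtain ⟨k0, k1⟩ := hkr r hr
      have b1 : |clamp P x.2| ≤ P := abs_le.mpr (clamp_mem hP _)
      have b2 := abs_accel_sub_le hl hL k0 (clamp P x.2) 0 (g x.1) 0
      have b3 : accel lam Lam (k / r) 0 0 = 0 := by simp [accel]
      rw [b3, sub_zero, sub_zero, sub_zero] at b2
      change max |clamp P x.2| |_| ≤ A
      have h0 : 0 ≤ c * (k / ε * (M * P) + C) := by positivity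
      refine max_le (by linarith) (b2.trans ?_)
      have e : c * (k / r * (M * |clamp P x.2|) + |g x.1|) ≤ c * (k / ε * (M * P) + C) := by
        gcongr
        exact hC _
      linarith
    · change A * max (T - ε) (ε - ε) ≤ A * T - 0
      rw [sub_self, max_eq_left (by linarith)]
      nlinarith
  obtain ⟨α, hα0, hα⟩ := hPL.exists_eq_forall_mem_Icc_hasDerivWithinAt₀
  have hα0' : α ε = (ξ, 0) := hα0
  have hcont : ContinuousOn α (Icc ε T) := fun r hr => (hα r hr).continuousWithinAt
  have hder : ∀ r ∈ Ioo ε T, HasDerivAt α (F r (α r)) r := fun r hr =>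
    (hα r (Ioo_subset_Icc_self hr)).hasDerivAt (Icc_mem_nhds hr.1 hr.2)
  have hdu : ∀ r ∈ Ioo ε T, HasDerivAt (fun r => (α r).1) (clamp P (α r).2) r :=
    fun r hr => (hder r hr).fst
  have hdp : ∀ r ∈ Ioo ε T, HasDerivAt (fun r => (α r).2)
      (accel lam Lam (k / r) (clamp P (α r).2) (g (α r).1)) r := fun r hr => (hder r hr).snd
  have hpb : ∀ r ∈ Icc ε T, |(α r).2| ≤ c * C * (r - ε) := by
    intro r hr
    have hsub : Ioo ε r ⊆ Ioo ε T := Ioo_subset_Ioo_right hr.2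
    have := abs_le_add_mul_of_deriv (A := 0) (C := c * C) hr.1 (by positivity)
      (hcont.snd.mono (Icc_subset_Icc_right hr.2)) (fun x hx => hdp x (hsub hx))
      (by simp [hα0']) (fun x hx h => ?_) (fun x hx h => ?_)
    · simpa using this
    · refine (accel_le_of_nonneg hl hL (hkr x (Ioo_subset_Icc_self (hsub hx))).1
        (clamp_nonneg hP h.le) _).trans ?_
      exact mul_le_mul_of_nonneg_left (hC _) hc.le
    · refine le_trans ?_ (le_accel_of_nonpos hl hL (hkr x (Ioo_subset_Icc_self (hsub hx))).1
        (clamp_nonpos hP h.le) _)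
      exact neg_le_neg (mul_le_mul_of_nonneg_left (hC _) hc.le)
  have hcl : ∀ r ∈ Icc ε T, clamp P (α r).2 = (α r).2 := by
    refine fun r hr => clamp_of_mem (abs_le.mp ((hpb r hr).trans ?_))
    exact mul_le_mul_of_nonneg_left (by linarith [hr.2]) (by positivity)
  have hub : ∀ r ∈ Icc ε T, |(α r).1 - ξ| ≤ c * C * r * (r - ε) := by
    intro r hr
    have hsub : Ioo ε r ⊆ Ioo ε T := Ioo_subset_Ioo_right hr.2
    have hr0 : 0 ≤ r := hε.le.trans hr.1
    have hp : ∀ x ∈ Ioo ε r, |clamp P (α x).2| ≤ c * C * r := fun x hx => by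
      rw [hcl x (Ioo_subset_Icc_self (hsub hx))]
      refine (hpb x (Ioo_subset_Icc_self (hsub hx))).trans ?_
      exact mul_le_mul_of_nonneg_left (by linarith [hx.2]) (by positivity)
    have := abs_le_add_mul_of_deriv (A := 0) (C := c * C * r) (f := fun r => (α r).1 - ξ) hr.1
      (by positivity) ((hcont.fst.mono (Icc_subset_Icc_right hr.2)).sub continuousOn_const)
      (fun x hx => (hdu x (hsub hx)).sub_const ξ)
      (by simp [hα0']) (fun x hx _ => (abs_le.mp (hp x hx)).2)
      (fun x hx _ => (abs_le.mp (hp x hx)).1)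
    simpa using this
  -- rest at `ξ` before the time `ε`
  have e1 : ∀ r ≥ ε, (if r ≤ ε then ξ else (α r).1) = (α r).1 := by
    intro r hr
    split_ifs with h
    · rw [le_antisymm h hr, hα0']
    · rfl
  have e2 : ∀ r ≥ ε, (if r ≤ ε then 0 else (α r).2) = (α r).2 := by
    intro r hr
    split_ifs with h
    · rw [le_antisymm h hr, hα0']
    · rfl
  refine ⟨fun r => if r ≤ ε then ξ else (α r).1, fun r => if r ≤ ε then 0 else (α r).2,
    fun r hr => by simp [hr], hcont.fst.congr fun r hr => e1 r hr.1,
    hcont.snd.congr fun r hr => e2 r hr.1, fun r hr => ?_, fun r hr => ?_, fun r hr => ?_,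
    fun r hr => ?_⟩
  · simp only [e2 r hr.1.le]
    rw [← hcl r (Ioo_subset_Icc_self hr)]
    refine (hdu r hr).congr_of_eventuallyEq ?_
    filter_upwards [lt_mem_nhds hr.1] with x hx using e1 x hx.le
  · simp only [e2 r hr.1.le, e1 r hr.1.le]
    have := hdp r hr
    rw [hcl r (Ioo_subset_Icc_self hr)] at this
    refine this.congr_of_eventuallyEq ?_
    filter_upwards [lt_mem_nhds hr.1] with x hx using e2 x hx.le
  · rcases le_total r ε with h | h
    · have := hr.1
      simp only [h, if_true, abs_zero]
      positivity
    · simp only [e2 r h]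
      exact (hpb r ⟨h, hr.2⟩).trans (mul_le_mul_of_nonneg_left (by linarith) (by positivity))
  · rcases le_total r ε with h | h
    · have := hr.1
      simp only [h, if_true, sub_self, abs_zero]
      positivity
    · have := hr.1
      simp only [e1 r h]
      exact (hub r ⟨h, hr.2⟩).trans (mul_le_mul_of_nonneg_left (by linarith) (by positivity))

lemma hasDerivWithinAt_zero_of_abs_le {f : ℝ → ℝ} {c C T : ℝ} (hT : 0 < T)
    (h : ∀ r ∈ Ico 0 T, |f r - f 0 - r * c| ≤ C * r ^ 2) : HasDerivWithinAt f c (Ici 0) 0 := by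
  rw [hasDerivWithinAt_iff_isLittleO]
  have h1 : (fun x : ℝ => x ^ 2) =o[𝓝[Ici 0] 0] fun x => x - 0 := by
    simpa using
      (Asymptotics.isLittleO_pow_id (𝕜 := ℝ) (n := 2) (by norm_num)).mono nhdsWithin_le_nhds
  refine Asymptotics.IsBigO.trans_isLittleO (Asymptotics.IsBigO.of_bound C ?_) h1
  filter_upwards [Ico_mem_nhdsGE hT] with r hr
  simpa [abs_of_nonneg (sq_nonneg r)] using h r hr

/-- The solutions of the equation on `(0, T)` obtained by delaying the start to a small time
converge in `C¹`; the limit solves the equation away from the singular point `r = 0`. -/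
lemma exists_solution_Ioo (hl : 0 < lam) (hL : 0 < Lam) (hk : 0 ≤ k) {C L : ℝ}
    (hC : ∀ s, |g s| ≤ C) (hL0 : 0 ≤ L) (hLip : ∀ s t, |g s - g t| ≤ L * |s - t|) (ξ : ℝ)
    {T : ℝ} (hT : 0 < T) : ∃ u p : ℝ → ℝ,
      (∀ r ∈ Icc 0 T, |p r| ≤ max lam⁻¹ Lam⁻¹ * C * r) ∧
      (∀ r ∈ Icc 0 T, |u r - ξ| ≤ max lam⁻¹ Lam⁻¹ * C * r * r) ∧
      ∀ r ∈ Ioo 0 T, HasDerivAt u (p r) r ∧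
        HasDerivAt p (accel lam Lam (k / r) (p r) (g (u r))) r := by
  set mx := max lam⁻¹ Lam⁻¹ with hmx_def
  set M := max lam Lam with hM_def
  have hmx : 0 < mx := lt_max_of_lt_left (inv_pos.mpr hl)
  have hM : 0 < M := lt_max_of_lt_left hl
  have hC0 : 0 ≤ C := (abs_nonneg _).trans (hC 0)
  set B := mx * C with hB_def
  have hB : 0 ≤ B := by positivity
  let ε : ℕ → ℝ := fun n => T / (n + 2)
  have hε0 : ∀ n, 0 < ε n := fun n => by positivity
  have hεT : ∀ n, ε n < T := fun n => div_lt_self hT (by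
    have : (0 : ℝ) ≤ n := n.cast_nonneg
    linarith)
  have hεanti : ∀ {n m}, n ≤ m → ε m ≤ ε n := fun {n m} h => by
    have : (n : ℝ) ≤ m := by exact_mod_cast h
    exact div_le_div_of_nonneg_left hT.le (by positivity) (by linarith)
  have hεlim : Tendsto ε atTop (𝓝 0) :=
    tendsto_const_nhds.div_atTop (tendsto_atTop_add_const_right _ _ tendsto_natCast_atTop_atTop)
  choose U P hrest hUc hPc hdU hdP hPb hUb using fun n =>
    exists_delayed_solution hl hL hk hC hL0 hLip ξ (hε0 n) (hεT n)
  -- the delayed solutions form a uniform Cauchy sequence in `C¹`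
  set D := Real.exp ((1 + mx * |L|) * T) with hD_def
  have hD : 1 ≤ D := Real.one_le_exp (by positivity)
  set D' := B * (1 + T) * D with hD'_def
  have hcauchy : ∀ n m, n ≤ m → ∀ r ∈ Icc 0 T,
      |U n r - U m r| ≤ D' * ε n ∧ |P n r - P m r| ≤ D' * ε n := by
    intro n m hnm r hr
    have hBD : B * (1 + T) ≤ D' := le_mul_of_one_le_right (by positivity) hD
    rcases le_total r (ε n) with h | h
    · obtain ⟨h1, h2⟩ := hrest n r h
      rw [h1, h2, abs_sub_comm, zero_sub, abs_neg]
      refine ⟨(hUb m r hr).trans ?_, (hPb m r hr).trans ?_⟩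
      · have : B * r * r ≤ B * T * ε n := by
          have := hr.1
          gcongr
          exact hr.2
        have := mul_le_mul_of_nonneg_right hBD (hε0 n).le
        nlinarith [mul_nonneg hB (hε0 n).le]
      · have : B * r ≤ B * ε n := mul_le_mul_of_nonneg_left h hB
        have := mul_le_mul_of_nonneg_right hBD (hε0 n).le
        nlinarith [mul_nonneg (mul_nonneg hB hT.le) (hε0 n).le]
    · have s1 : Icc (ε n) r ⊆ Icc (ε n) T := Icc_subset_Icc_right hr.2
      have s2 : Icc (ε n) r ⊆ Icc (ε m) T := Icc_subset_Icc (hεanti hnm) hr.2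
      have s3 : Ioo (ε n) r ⊆ Ioo (ε n) T := Ioo_subset_Ioo_right hr.2
      have s4 : Ioo (ε n) r ⊆ Ioo (ε m) T := Ioo_subset_Ioo (hεanti hnm) hr.2
      have key := sq_add_sq_le_of_accel (g := g) (L := L) hl hL hk (hε0 n).le h
        ((hUc n).mono s1) ((hPc n).mono s1) ((hUc m).mono s2) ((hPc m).mono s2)
        (fun x hx => hdU n x (s3 hx)) (fun x hx => hdP n x (s3 hx))
        (fun x hx => hdU m x (s4 hx)) (fun x hx => hdP m x (s4 hx)) (fun x _ => hLip _ _)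
      obtain ⟨h1, h2⟩ := hrest n (ε n) le_rfl
      have b1 : (U n (ε n) - U m (ε n)) ^ 2 ≤ (B * T * ε n) ^ 2 := by
        rw [h1, sq_le_sq, abs_sub_comm, abs_of_nonneg (a := B * T * ε n) (by positivity)]
        refine (hUb m _ ⟨(hε0 n).le, (hεT n).le⟩).trans ?_
        have := hε0 n
        gcongr
        exact (hεT n).le
      have b2 : (P n (ε n) - P m (ε n)) ^ 2 ≤ (B * ε n) ^ 2 := by
        rw [h2, sq_le_sq, zero_sub, abs_neg, abs_of_nonneg (a := B * ε n) (by positivity)]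
        exact hPb m _ ⟨(hε0 n).le, (hεT n).le⟩
      have b3 : Real.exp ((1 + mx * |L|) * (r - ε n)) ≤ D := by
        refine Real.exp_le_exp.mpr (mul_le_mul_of_nonneg_left ?_ (by positivity))
        linarith [hr.2, hε0 n]
      have b4 : (U n r - U m r) ^ 2 + (P n r - P m r) ^ 2 ≤ (D' * ε n) ^ 2 := by
        calc _ ≤ _ := key
          _ ≤ ((B * T * ε n) ^ 2 + (B * ε n) ^ 2) * D := by
            gcongr
          _ ≤ (B * (1 + T) * ε n) ^ 2 * (D * D) := by
            gcongr ?_ * ?_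
            · nlinarith [mul_nonneg (sq_nonneg (B * ε n)) hT.le]
            · exact le_mul_of_one_le_left (by positivity) hD
          _ = _ := by rw [hD'_def]; ring
      have hDε : 0 ≤ D' * ε n := mul_nonneg (by positivity) (hε0 n).le
      exact ⟨abs_le_of_sq_le_sq (by nlinarith [sq_nonneg (P n r - P m r)]) hDε,
        abs_le_of_sq_le_sq (by nlinarith [sq_nonneg (U n r - U m r)]) hDε⟩
  have hDlim : Tendsto (fun n => D' * ε n) atTop (𝓝 0) := by simpa using hεlim.const_mul D'
  have hlim : ∀ (V : ℕ → ℝ → ℝ), (∀ n m, n ≤ m → ∀ r ∈ Icc 0 T, |V n r - V m r| ≤ D' * ε n) →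
      ∃ v : ℝ → ℝ, ∀ r ∈ Icc 0 T, Tendsto (fun n => V n r) atTop (𝓝 (v r)) ∧
        ∀ n, |V n r - v r| ≤ D' * ε n := by
    intro V hV
    have h : ∀ r, ∃ v, r ∈ Icc 0 T → Tendsto (fun n => V n r) atTop (𝓝 v) := by
      intro r
      by_cases hr : r ∈ Icc 0 T
      · obtain ⟨v, hv⟩ := cauchySeq_tendsto_of_complete
          (cauchySeq_of_le_tendsto_0' (s := fun n => V n r) (fun n => D' * ε n)
            (fun n m h => hV n m h r hr) hDlim)
        exact ⟨v, fun _ => hv⟩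
      · exact ⟨0, fun h => absurd h hr⟩
    choose v hv using h
    refine ⟨v, fun r hr => ⟨hv r hr, fun n => ?_⟩⟩
    refine le_of_tendsto ((tendsto_const_nhds.sub (hv r hr)).abs) ?_
    filter_upwards [eventually_ge_atTop n] with m hm using hV n m hm r hr
  obtain ⟨u, hu⟩ := hlim U fun n m h r hr => (hcauchy n m h r hr).1
  obtain ⟨p, hp⟩ := hlim P fun n m h r hr => (hcauchy n m h r hr).2
  have hpb : ∀ r ∈ Icc 0 T, |p r| ≤ B * r := fun r hr =>
    le_of_tendsto (hp r hr).1.abs (Eventually.of_forall fun n => hPb n r hr)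
  have hub : ∀ r ∈ Icc 0 T, |u r - ξ| ≤ B * r * r := fun r hr =>
    le_of_tendsto ((hu r hr).1.sub_const ξ).abs (Eventually.of_forall fun n => hUb n r hr)
  -- away from the singularity the derivatives converge uniformly
  refine ⟨u, p, hpb, hub, fun r hr => ?_⟩
  have hr2 : 0 < r / 2 := half_pos hr.1
  have hrI : r ∈ Ioo (r / 2) T := ⟨half_lt_self hr.1, hr.2⟩
  have hsub : Ioo (r / 2) T ⊆ Icc 0 T := fun x hx => ⟨hr2.le.trans hx.1.le, hx.2.le⟩
  have hev : ∀ᶠ n in atTop, ε n < r / 2 := hεlim.eventually_lt_const hr2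
  have hin : ∀ n, ε n < r / 2 → ∀ x ∈ Ioo (r / 2) T, x ∈ Ioo (ε n) T :=
    fun n hn x hx => ⟨hn.trans hx.1, hx.2⟩
  constructor
  · refine hasDerivAt_of_tendstoUniformlyOn (f := U) (f' := P) (l := atTop) isOpen_Ioo ?_ ?_
      (fun x hx => (hu x (hsub hx)).1) hrI
    · rw [Metric.tendstoUniformlyOn_iff]
      intro δ hδ
      filter_upwards [hDlim.eventually_lt_const hδ] with n hn x hx
      rw [dist_comm]
      exact ((hp x (hsub hx)).2 n).trans_lt hn
    · filter_upwards [hev] with n hn x hx using hdU n x (hin n hn x hx)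
  · refine hasDerivAt_of_tendstoUniformlyOn (f := P) (l := atTop)
      (f' := fun n x => accel lam Lam (k / x) (P n x) (g (U n x)))
      (g' := fun x => accel lam Lam (k / x) (p x) (g (u x))) isOpen_Ioo ?_ ?_
      (fun x hx => (hp x (hsub hx)).1) hrI
    · rw [Metric.tendstoUniformlyOn_iff]
      intro δ hδ
      have hlim2 : Tendsto (fun n => mx * (k / (r / 2) * (M * (D' * ε n)) + L * (D' * ε n)))
          atTop (𝓝 0) := by
        simpa using (((hDlim.const_mul M).const_mul (k / (r / 2))).add
          (hDlim.const_mul L)).const_mul mx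
      filter_upwards [hlim2.eventually_lt_const hδ] with n hn x hx
      rw [dist_comm]
      have hx0 : 0 < x := hr2.trans hx.1
      refine lt_of_le_of_lt ((abs_accel_sub_le hl hL (by positivity) _ _ _ _).trans ?_) hn
      have e1 := (hp x (hsub hx)).2 n
      have e2 := (hLip (U n x) (u x)).trans
        (mul_le_mul_of_nonneg_left ((hu x (hsub hx)).2 n) hL0)
      have e3 : k / x ≤ k / (r / 2) := div_le_div_of_nonneg_left hk hr2 hx.1.le
      gcongr
    · filter_upwards [hev] with n hn x hx using hdP n x (hin n hn x hx)

/-- For a bounded Lipschitz nonlinearity there are solutions on every bounded interval `[0, T)`, of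
class `C²` up to the origin. -/
lemma exists_sol_of_bounded (hl : 0 < lam) (hL : 0 < Lam) (hk : 0 ≤ k) {C L : ℝ}
    (hC : ∀ s, |g s| ≤ C) (hL0 : 0 ≤ L) (hLip : ∀ s t, |g s - g t| ≤ L * |s - t|) (ξ : ℝ)
    {T : ℝ} (hT : 0 < T) : ∃ u p q : ℝ → ℝ, Sol lam Lam k g ξ T u p q := by
  have hgc : Continuous g := by
    have : LipschitzWith L.toNNReal g := by
      refine LipschitzWith.of_dist_le_mul fun s t => ?_
      rw [Real.coe_toNNReal _ hL0]
      exact hLip s t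
    exact this.continuous
  obtain ⟨u, p, hpb, hub, hderiv⟩ := exists_solution_Ioo hl hL hk hC hL0 hLip ξ hT
  set mx := max lam⁻¹ Lam⁻¹ with hmx_def
  set M := max lam Lam with hM_def
  have hmx : 0 < mx := lt_max_of_lt_left (inv_pos.mpr hl)
  have hM : 0 < M := lt_max_of_lt_left hl
  have hC0 : 0 ≤ C := (abs_nonneg _).trans (hC 0)
  set B := mx * C with hB_def
  have hB : 0 ≤ B := by positivity
  have h0T : (0 : ℝ) ∈ Icc 0 T := ⟨le_rfl, hT.le⟩
  have hu0 : u 0 = ξ := by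
    have := hub 0 h0T
    simp only [mul_zero, abs_nonpos_iff] at this
    linarith
  have hp0 : p 0 = 0 := by simpa using hpb 0 h0T
  -- the second derivative at the origin, where `p r / r` tends to `c`
  set c := pw lam⁻¹ Lam⁻¹ (-(g ξ) / (1 + k)) with hc_def
  have hc : ∀ r, 0 < r → c = accel lam Lam (k / r) (r * c) (g ξ) := by
    intro r hr
    rw [accel_eq_iff hl hL]
    have h1 : pw lam Lam (r * c) = r * pw lam Lam c := by
      rcases le_total 0 c with h | h
      · rw [pw_of_nonneg h, pw_of_nonneg (by positivity)]; ring
      · rw [pw_of_nonpos h, pw_of_nonpos (mul_nonpos_of_nonneg_of_nonpos hr.le h)]; ring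
    rw [h1, hc_def, pw_pw_inv hl hL]
    field_simp
    ring
  have hpc : ContinuousOn p (Ico 0 T) := by
    intro r hr
    rcases hr.1.lt_or_eq with h | rfl
    · exact (hderiv r ⟨h, hr.2⟩).2.continuousAt.continuousWithinAt
    · rw [ContinuousWithinAt, hp0]
      refine squeeze_zero_norm' (a := fun r => B * r) ?_ ?_
      · filter_upwards [self_mem_nhdsWithin] with r hr
        exact hpb r ⟨hr.1, hr.2.le⟩
      · have : Continuous fun r : ℝ => B * r := by fun_prop
        simpa using (this.tendsto 0).mono_left nhdsWithin_le_nhds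
  have hpcr : ∀ r ∈ Ico 0 T, |p r - r * c| ≤ mx * L * B * r ^ 2 * r := by
    intro r hr
    have hbd : ∀ x ∈ Ioo 0 r, |accel lam Lam (k / x) (x * c) (g (u x)) - c|
        ≤ mx * L * B * r ^ 2 := by
      intro x hx
      have hxT : x ∈ Icc 0 T := ⟨hx.1.le, hx.2.le.trans hr.2.le⟩
      have h1 := abs_accel_sub_le hl hL (div_nonneg hk hx.1.le) (x * c) (x * c) (g (u x)) (g ξ)
      rw [← hc x hx.1, sub_self, abs_zero, mul_zero, mul_zero, zero_add] at h1
      refine h1.trans ?_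
      have h2 := (hLip (u x) ξ).trans (mul_le_mul_of_nonneg_left (hub x hxT) hL0)
      have h3 : L * (B * x * x) ≤ L * (B * r * r) := by
        have := hx.1.le
        have := hx.2.le
        have := hr.1
        gcongr
      have := mul_le_mul_of_nonneg_left (h2.trans h3) hmx.le
      linarith
    have := abs_le_add_mul_of_deriv (A := 0) (C := mx * L * B * r ^ 2) (f := fun r => p r - r * c)
      hr.1 (by positivity)
      ((hpc.mono fun x hx => ⟨hx.1, hx.2.trans_lt hr.2⟩).sub (by fun_prop))
      (fun x hx => (hderiv x ⟨hx.1, hx.2.trans hr.2⟩).2.sub ((hasDerivAt_id x).mul_const c))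
      (by simp [hp0]) (fun x hx h => ?_) (fun x hx h => ?_)
    · simpa using this
    · have h1 := accel_dissipative hl hL (div_nonneg hk hx.1.le) (p x) (x * c) (g (u x))
      have h2 := (abs_le.mp (hbd x hx)).2
      rw [one_mul]
      by_contra! h3
      nlinarith
    · have h1 := accel_dissipative hl hL (div_nonneg hk hx.1.le) (p x) (x * c) (g (u x))
      have h2 := (abs_le.mp (hbd x hx)).1
      rw [one_mul]
      by_contra! h3
      nlinarith
  let q : ℝ → ℝ := fun r => if r ≤ 0 then c else accel lam Lam (k / r) (p r) (g (u r))
  have hq0 : q 0 = c := if_pos le_rfl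
  have hqpos : ∀ r, 0 < r → q r = accel lam Lam (k / r) (p r) (g (u r)) :=
    fun r hr => if_neg (not_le.mpr hr)
  have hTpos : (0 : EReal) < (T : EReal) := by exact_mod_cast hT
  refine ⟨u, p, q, hTpos, fun r hr => ?_, fun r hr => ?_, fun r hr => ?_, hu0, hp0,
    fun r _ h => hqpos r h⟩
  · rw [hasDerivWithinAt_dom_iff hr.2]
    rw [dom_coe] at hr
    rcases hr.1.lt_or_eq with h | rfl
    · exact (hderiv r ⟨h, hr.2⟩).1.hasDerivWithinAt
    · refine hasDerivWithinAt_zero_of_abs_le (C := B) hT fun r hr => ?_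
      rw [hu0, hp0, mul_zero, sub_zero]
      exact (hub r ⟨hr.1, hr.2.le⟩).trans (by nlinarith)
  · rw [hasDerivWithinAt_dom_iff hr.2]
    rw [dom_coe] at hr
    rcases hr.1.lt_or_eq with h | rfl
    · rw [hqpos r h]
      exact (hderiv r ⟨h, hr.2⟩).2.hasDerivWithinAt
    · refine hasDerivWithinAt_zero_of_abs_le (C := mx * L * B * T) hT fun r hr => ?_
      rw [hq0, hp0, sub_zero]
      refine (hpcr r hr).trans ?_
      have : mx * L * B * r ^ 2 * r ≤ mx * L * B * r ^ 2 * T :=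
        mul_le_mul_of_nonneg_left hr.2.le (by positivity)
      linarith
  · rw [dom_coe] at hr ⊢
    rcases hr.1.lt_or_eq with h | rfl
    · have hd := hderiv r ⟨h, hr.2⟩
      have hcont : ContinuousAt (fun r => accel lam Lam (k / r) (p r) (g (u r))) r := by
        refine (continuous_pw (inv_pos.mpr hl) (inv_pos.mpr hL)).continuousAt.comp ?_
        refine (ContinuousAt.neg (ContinuousAt.mul (continuousAt_const.div continuousAt_id h.ne')
          ((continuous_pw hl hL).continuousAt.comp hd.2.continuousAt))).sub
          (hgc.continuousAt.comp hd.1.continuousAt)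
      refine (hcont.congr ?_).continuousWithinAt
      filter_upwards [lt_mem_nhds h] with x hx using (hqpos x hx).symm
    · rw [ContinuousWithinAt, hq0, tendsto_iff_norm_sub_tendsto_zero]
      set E := mx * (k * (M * (mx * L * B)) + L * B) with hE_def
      refine squeeze_zero_norm' (a := fun r => E * r ^ 2) ?_ ?_
      · filter_upwards [self_mem_nhdsWithin] with r hr
        rw [norm_norm, Real.norm_eq_abs]
        rcases hr.1.lt_or_eq with h | rfl
        · rw [hqpos r h]
          have e0 := abs_accel_sub_le hl hL (div_nonneg hk hr.1) (p r) (r * c) (g (u r)) (g ξ)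
          rw [← hc r h] at e0
          refine e0.trans ?_
          have e1 := hpcr r hr
          have e2 := (hLip (u r) ξ).trans
            (mul_le_mul_of_nonneg_left (hub r ⟨hr.1, hr.2.le⟩) hL0)
          have e3 : k / r * (M * |p r - r * c|) ≤ k * (M * (mx * L * B)) * r ^ 2 := by
            calc k / r * (M * |p r - r * c|) ≤ k / r * (M * (mx * L * B * r ^ 2 * r)) := by
                  gcongr
              _ = _ := by field_simp
          have := mul_le_mul_of_nonneg_left (add_le_add e3 e2) hmx.le
          refine this.trans (le_of_eq ?_)
          rw [hE_def]; ring
        · simp [hq0]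
      · have : Continuous fun r : ℝ => E * r ^ 2 := by fun_prop
        simpa using (this.tendsto 0).mono_left nhdsWithin_le_nhds

end

/-! ### Maximal solutions -/

section
variable {lam Lam k : ℝ} {N : ℕ} {g : ℝ → ℝ} {ξ : ℝ} {R : EReal} {u p q : ℝ → ℝ}

lemma exists_abs_comp_clamp_sub_le (hg : LocallyLipschitz g) {M : ℝ} (hM : 0 ≤ M) :
    ∃ L : ℝ, 0 ≤ L ∧ ∀ s t, |g (clamp M s) - g (clamp M t)| ≤ L * |s - t| := by
  obtain ⟨L, hL0, hLip⟩ := exists_abs_sub_le_of_locallyLipschitz hg M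
  exact ⟨L, hL0, fun s t => (hLip _ (clamp_mem hM s) _ (clamp_mem hM t)).trans
    (mul_le_mul_of_nonneg_left (abs_clamp_sub_le M s t) hL0)⟩

lemma exists_sol_comp_clamp (hl : 0 < lam) (hL : 0 < Lam) (hk : 0 ≤ k) (hg : LocallyLipschitz g)
    {M : ℝ} (hM : 0 ≤ M) (ξ : ℝ) {T : ℝ} (hT : 0 < T) :
    ∃ u p q : ℝ → ℝ, Sol lam Lam k (fun s => g (clamp M s)) ξ T u p q := by
  obtain ⟨L, hL0, hLip⟩ := exists_abs_comp_clamp_sub_le hg hM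
  obtain ⟨C, hC⟩ := (isCompact_Icc (a := -M) (b := M)).exists_bound_of_continuousOn
    hg.continuous.continuousOn
  exact exists_sol_of_bounded hl hL hk (fun s => hC _ (clamp_mem hM s)) hL0 hLip ξ hT

lemma locallyLipschitz_comp_clamp (hg : LocallyLipschitz g) {M : ℝ} (hM : 0 ≤ M) :
    LocallyLipschitz fun s => g (clamp M s) := by
  obtain ⟨L, hL0, hLip⟩ := exists_abs_comp_clamp_sub_le hg hM
  have : LipschitzWith L.toNNReal fun s => g (clamp M s) := by
    refine LipschitzWith.of_dist_le_mul fun s t => ?_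
    rw [Real.coe_toNNReal _ hL0]
    exact hLip s t
  exact this.locallyLipschitz

namespace Sol

/-- As long as its values stay away from the truncation level, a solution of the truncated problem
solves the original one, slightly beyond the given radius. -/
lemma exists_of_comp_clamp {M T r : ℝ}
    (h : Sol lam Lam k (fun s => g (clamp M s)) ξ T u p q) (hr : r ∈ Ico 0 T)
    (hM : ∀ s ∈ Icc 0 r, |u s| < M) : ∃ S : ℝ, r < S ∧ Sol lam Lam k g ξ S u p q := by
  have hr' : r ∈ dom T := by rwa [dom_coe]
  have hc : ContinuousWithinAt u (Ici 0) r :=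
    (continuousWithinAt_dom_iff hr'.2).mp (h.continuousOn_u r hr')
  have hev : ∀ᶠ s in 𝓝[Ici 0] r, |u s| < M :=
    hc.abs.eventually_lt_const (hM r ⟨hr.1, le_rfl⟩)
  obtain ⟨δ, hδ, hball⟩ := Metric.mem_nhdsWithin_iff.mp hev
  have hS : r < min (r + δ) T := lt_min (by linarith) hr.2
  refine ⟨min (r + δ) T, hS, ?_⟩
  refine (h.mono (R' := ((min (r + δ) T : ℝ) : EReal)) ?_ ?_).congr_nonlinearity fun s hs => ?_
  · exact_mod_cast hr.1.trans_lt hS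
  · exact_mod_cast min_le_right _ _
  · rw [dom_coe] at hs
    have : |u s| < M := by
      rcases le_or_gt s r with h1 | h1
      · exact hM s ⟨hs.1, h1⟩
      · refine hball ⟨?_, hs.1⟩
        rw [Metric.mem_ball, Real.dist_eq, abs_of_pos (by linarith)]
        linarith [hs.2.trans_le (min_le_left _ _)]
    rw [clamp_of_mem (abs_le.mp this.le)]

end Sol

lemma exists_local_sol (hl : 0 < lam) (hL : 0 < Lam) (hk : 0 ≤ k) (hg : LocallyLipschitz g)
    (ξ : ℝ) : ∃ (R : EReal) (u p q : ℝ → ℝ), Sol lam Lam k g ξ R u p q := by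
  obtain ⟨u, p, q, h⟩ := exists_sol_comp_clamp hl hL hk hg (M := |ξ| + 1) (by positivity) ξ one_pos
  obtain ⟨S, -, hS⟩ := h.exists_of_comp_clamp (r := 0) ⟨le_rfl, one_pos⟩ fun s hs => by
    rw [le_antisymm hs.2 hs.1, h.u0]; linarith
  exact ⟨S, u, p, q, hS⟩

/-- A bounded maximal solution is global. -/
lemma IsMaximalSolution.eq_top_of_bounded (hl : 0 < lam) (hL : 0 < Lam) (hN : 1 ≤ N)
    (hg : LocallyLipschitz g) (h : IsMaximalSolution lam Lam N g ξ R u) {M : ℝ}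
    (hM : ∀ r ∈ dom R, |u r| ≤ M) : R = ⊤ := by
  have hk : (0 : ℝ) ≤ N - 1 := by
    have : (1 : ℝ) ≤ N := by exact_mod_cast hN
    linarith
  by_contra hR
  have hsol := h.1.sol hl hL
  lift R to ℝ using ⟨hR, (EReal.bot_lt_zero.trans h.1.pos).ne'⟩
  have hR0 : 0 < R := by exact_mod_cast h.1.pos
  have hM0 : 0 ≤ M := (abs_nonneg _).trans (hM 0 (zero_mem_dom h.1.pos))
  have hM1 : 0 ≤ M + 1 := by linarith
  obtain ⟨v, p, q, hv⟩ := exists_sol_comp_clamp hl hL hk hg hM1 ξ (T := R + 1) (by linarith)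
  have hle : (R : EReal) ≤ ((R + 1 : ℝ) : EReal) := by exact_mod_cast (lt_add_one R).le
  have hsol' : Sol lam Lam (N - 1) (fun s => g (clamp (M + 1) s)) ξ R u _ _ :=
    hsol.congr_nonlinearity fun r hr => by
      rw [clamp_of_mem (abs_le.mp ((hM r hr).trans (by linarith)))]
  have heq : EqOn v u (dom R) := fun r hr =>
    (Sol.unique hl hL hk (locallyLipschitz_comp_clamp hg hM1) hv hsol' (dom_mono hle hr) hr).1
  have hRmem : R ∈ dom ((R + 1 : ℝ) : EReal) := by rw [dom_coe]; exact ⟨hR0.le, lt_add_one R⟩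
  have hvR : |v R| ≤ M := by
    have hc : ContinuousAt v R := (hv.hasDerivAt_u hRmem hR0).continuousAt
    have hlim : Tendsto (fun r => |v r|) (𝓝[<] R) (𝓝 |v R|) := hc.abs.tendsto.mono_left inf_le_left
    refine le_of_tendsto hlim ?_
    filter_upwards [Ioo_mem_nhdsLT hR0] with r hr
    have hr' : r ∈ dom (R : EReal) := by rw [dom_coe]; exact ⟨hr.1.le, hr.2⟩
    rw [heq hr']
    exact hM r hr'
  obtain ⟨S, hRS, hS⟩ := hv.exists_of_comp_clamp ⟨hR0.le, lt_add_one R⟩ fun s hs => by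
    rcases hs.2.lt_or_eq with h1 | rfl
    · have hs' : s ∈ dom (R : EReal) := by rw [dom_coe]; exact ⟨hs.1, h1⟩
      rw [heq hs']
      linarith [hM s hs']
    · linarith
  have := h.2 S v (hS.isSolution hl hL) heq
  exact absurd (EReal.coe_le_coe_iff.mp this) (not_le.mpr hRS)

/-- By uniqueness, all solutions glue together. -/
lemma exists_isMaximalSolution (hl : 0 < lam) (hL : 0 < Lam) (hN : 1 ≤ N)
    (hg : LocallyLipschitz g) (ξ : ℝ) :
    ∃ (R : EReal) (u : ℝ → ℝ), IsMaximalSolution lam Lam N g ξ R u := by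
  have hk : (0 : ℝ) ≤ N - 1 := by
    have : (1 : ℝ) ≤ N := by exact_mod_cast hN
    linarith
  let S : Set EReal := {R | ∃ u p q : ℝ → ℝ, Sol lam Lam (N - 1) g ξ R u p q}
  have hex : ∀ r : ℝ, ∃ a b c : ℝ, r ∈ dom (sSup S) → ∃ (R : EReal) (u p q : ℝ → ℝ),
      Sol lam Lam (N - 1) g ξ R u p q ∧ r ∈ dom R ∧ u r = a ∧ p r = b ∧ q r = c := by
    intro r
    by_cases hr : r ∈ dom (sSup S)
    · obtain ⟨R, ⟨u, p, q, h⟩, hrR⟩ := lt_sSup_iff.mp hr.2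
      exact ⟨u r, p r, q r, fun _ => ⟨R, u, p, q, h, ⟨hr.1, hrR⟩, rfl, rfl, rfl⟩⟩
    · exact ⟨0, 0, 0, fun h => absurd h hr⟩
  choose u p q hupq using hex
  have hS : ∀ R ∈ S, R ≤ sSup S := fun R hR => le_sSup hR
  have hglue : ∀ {R : EReal} {v v' v'' : ℝ → ℝ}, Sol lam Lam (N - 1) g ξ R v v' v'' →
      ∀ r ∈ dom R, u r = v r ∧ p r = v' r ∧ q r = v'' r := by
    intro R v v' v'' h r hr
    obtain ⟨R₁, u₁, p₁, q₁, h₁, hr₁, e1, e2, e3⟩ := hupq r (dom_mono (hS R ⟨v, v', v'', h⟩) hr)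
    rw [← e1, ← e2, ← e3]
    exact Sol.unique hl hL hk hg h₁ h hr₁ hr
  obtain ⟨R₀, u₀, p₀, q₀, h₀⟩ := exists_local_sol hl hL hk hg ξ
  have hz := hglue h₀ 0 (zero_mem_dom h₀.pos)
  have hsol : Sol lam Lam (N - 1) g ξ (sSup S) u p q := by
    refine ⟨h₀.pos.trans_le (hS R₀ ⟨u₀, p₀, q₀, h₀⟩), fun r hr => ?_, fun r hr => ?_,
      fun r hr => ?_, hz.1.trans h₀.u0, hz.2.1.trans h₀.p0, fun r hr hr0 => ?_⟩ <;>
      obtain ⟨R, v, v', v'', h, hrR, -⟩ := hupq r hr <;> have hgl := hglue h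
    · rw [hasDerivWithinAt_dom_iff hr.2, ← hasDerivWithinAt_dom_iff hrR.2, (hgl r hrR).2.1]
      exact (h.hu r hrR).congr (fun s hs => (hgl s hs).1) (hgl r hrR).1
    · rw [hasDerivWithinAt_dom_iff hr.2, ← hasDerivWithinAt_dom_iff hrR.2, (hgl r hrR).2.2]
      exact (h.hp r hrR).congr (fun s hs => (hgl s hs).2.1) (hgl r hrR).2.1
    · rw [continuousWithinAt_dom_iff hr.2, ← continuousWithinAt_dom_iff hrR.2]
      exact (h.hq r hrR).congr (fun s hs => (hgl s hs).2.2) (hgl r hrR).2.2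
    · rw [(hgl r hrR).1, (hgl r hrR).2.1, (hgl r hrR).2.2]
      exact h.eqn r hrR hr0
  exact ⟨sSup S, u, hsol.isSolution hl hL,
    fun R' v hv _ => hS R' ⟨v, _, _, hv.sol hl hL⟩⟩

end

/-! ### The energy -/

lemma hasDerivAt_prim {g : ℝ → ℝ} (hg : Continuous g) (t : ℝ) : HasDerivAt (prim g) (g t) t :=
  intervalIntegral.integral_hasDerivAt_right (hg.intervalIntegrable _ _)
    (hg.stronglyMeasurableAtFilter _ _) hg.continuousAt

lemma continuous_prim {g : ℝ → ℝ} (hg : Continuous g) : Continuous (prim g) :=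
  continuous_iff_continuousAt.mpr fun t => (hasDerivAt_prim hg t).continuousAt

@[simp] lemma prim_zero {g : ℝ → ℝ} : prim g 0 = 0 := by simp [prim]

lemma strictMonoOn_prim {g : ℝ → ℝ} {a b : ℝ} (hg : Continuous g) (h : ∀ s ∈ Ioo a b, 0 < g s) :
    StrictMonoOn (prim g) (Icc a b) := by
  refine strictMonoOn_of_deriv_pos (convex_Icc a b) (continuous_prim hg).continuousOn ?_
  rw [interior_Icc]
  exact fun s hs => by rw [(hasDerivAt_prim hg s).deriv]; exact h s hs

/-- The equation without damping reads `u'' + force (u) = 0`: the slope at which `g` is divided is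
that of the operator on `-g u`. -/
noncomputable def force (lam Lam : ℝ) (g : ℝ → ℝ) (s : ℝ) : ℝ := pw Lam⁻¹ lam⁻¹ (g s)

/-- The energy of a solution. In general its potential is not a multiple of the primitive of `g`:
the two differ by a factor that depends on the sign of `g`. -/
noncomputable def energy (lam Lam : ℝ) (g u p : ℝ → ℝ) (r : ℝ) : ℝ :=
  p r ^ 2 / 2 + prim (force lam Lam g) (u r)

section
variable {lam Lam k : ℝ} {g : ℝ → ℝ} {ξ : ℝ} {R α : EReal} {u p q : ℝ → ℝ}

lemma accel_zero_speed {κ y : ℝ} : accel lam Lam κ 0 y = -pw Lam⁻¹ lam⁻¹ y := by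
  rw [← pw_neg]; simp [accel]

lemma continuous_force (hl : 0 < lam) (hL : 0 < Lam) (hg : Continuous g) :
    Continuous (force lam Lam g) :=
  (continuous_pw (inv_pos.mpr hL) (inv_pos.mpr hl)).comp hg

lemma force_of_nonneg {s : ℝ} (h : 0 ≤ g s) : force lam Lam g s = lam⁻¹ * g s := pw_of_nonneg h

lemma force_neg_of_nonneg (hg : Function.Odd g) {s : ℝ} (h : 0 ≤ g s) :
    force lam Lam g (-s) = -(Lam⁻¹ * g s) := by
  rw [force, hg s, pw_neg, pw_of_nonneg h]

lemma prim_force_of_nonneg {t : ℝ} (ht : 0 ≤ t) (h : ∀ s ∈ Icc 0 t, 0 ≤ g s) :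
    prim (force lam Lam g) t = lam⁻¹ * prim g t := by
  rw [prim, prim, ← intervalIntegral.integral_const_mul]
  refine intervalIntegral.integral_congr fun s hs => ?_
  rw [uIcc_of_le ht] at hs
  exact force_of_nonneg (h s hs)

lemma prim_force_neg_of_nonneg (hg : Function.Odd g) {t : ℝ} (ht : 0 ≤ t)
    (h : ∀ s ∈ Icc 0 t, 0 ≤ g s) : prim (force lam Lam g) (-t) = Lam⁻¹ * prim g t := by
  have e : ∫ s in (0 : ℝ)..t, force lam Lam g (-s) = ∫ s in -t..0, force lam Lam g s := by
    simp
  rw [prim, prim, intervalIntegral.integral_symm, ← e, ← intervalIntegral.integral_const_mul,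
    ← intervalIntegral.integral_neg]
  refine intervalIntegral.integral_congr fun s hs => ?_
  rw [uIcc_of_le ht] at hs
  simp only [force_neg_of_nonneg hg (h s hs), neg_neg]

namespace Sol

lemma hasDerivAt_energy (hl : 0 < lam) (hL : 0 < Lam) (hg : Continuous g)
    (h : Sol lam Lam k g ξ R u p q) {r : ℝ} (hr : r ∈ dom R) (h0 : 0 < r) :
    HasDerivAt (energy lam Lam g u p) (p r * (q r + force lam Lam g (u r))) r := by
  have h1 := ((h.hasDerivAt_p hr h0).pow 2).div_const 2
  have h2 := (hasDerivAt_prim (continuous_force hl hL hg) (u r)).comp r (h.hasDerivAt_u hr h0)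
  exact (h1.add h2).congr_deriv (by norm_num; ring)

lemma mul_add_force_le (hl : 0 < lam) (hL : 0 < Lam) (hk : 0 ≤ k)
    (h : Sol lam Lam k g ξ R u p q) {r : ℝ} (hr : r ∈ dom R) (h0 : 0 < r) :
    p r * (q r + force lam Lam g (u r))
      ≤ -(min lam⁻¹ Lam⁻¹ * min lam Lam * (k / r) * p r ^ 2) := by
  have := mul_accel_sub_le hl hL (div_nonneg hk h0.le) (p r) (g (u r))
  rwa [← h.eqn r hr h0, accel_zero_speed, sub_neg_eq_add] at this

lemma abs_add_force_le (hl : 0 < lam) (hL : 0 < Lam) (hk : 0 ≤ k)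
    (h : Sol lam Lam k g ξ R u p q) {r : ℝ} (hr : r ∈ dom R) (h0 : 0 < r) :
    |q r + force lam Lam g (u r)| ≤ max lam⁻¹ Lam⁻¹ * max lam Lam * k / r * |p r| := by
  have := abs_accel_sub_le hl hL (div_nonneg hk h0.le) (p r) 0 (g (u r)) (g (u r))
  rw [← h.eqn r hr h0, accel_zero_speed, sub_neg_eq_add, sub_self, abs_zero, add_zero,
    sub_zero] at this
  refine this.trans (le_of_eq ?_)
  ring

lemma continuousOn_energy (hl : 0 < lam) (hL : 0 < Lam) (hg : Continuous g)
    (h : Sol lam Lam k g ξ R u p q) : ContinuousOn (energy lam Lam g u p) (dom R) :=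
  ((h.continuousOn_p.pow 2).div_const 2).add
    ((continuous_prim (continuous_force hl hL hg)).comp_continuousOn h.continuousOn_u)

lemma antitoneOn_energy (hl : 0 < lam) (hL : 0 < Lam) (hk : 0 ≤ k) (hg : Continuous g)
    (h : Sol lam Lam k g ξ R u p q) : AntitoneOn (energy lam Lam g u p) (dom R) := by
  intro a ha b hb hab
  have hm : ∀ r ∈ Ioo a b, r ∈ dom R ∧ 0 < r := fun r hr =>
    ⟨mem_dom_of_le hb (ha.1.trans hr.1.le) hr.2.le, ha.1.trans_lt hr.1⟩
  refine antitoneOn_Icc_of_hasDerivAt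
    ((h.continuousOn_energy hl hL hg).mono fun r hr => mem_dom_of_le hb (ha.1.trans hr.1) hr.2)
    (fun r hr => h.hasDerivAt_energy hl hL hg (hm r hr).1 (hm r hr).2)
    (fun r hr => (h.mul_add_force_le hl hL hk (hm r hr).1 (hm r hr).2).trans ?_)
    ⟨le_rfl, hab⟩ ⟨hab, le_rfl⟩ hab
  have h1 : 0 < min lam⁻¹ Lam⁻¹ := lt_min (inv_pos.mpr hl) (inv_pos.mpr hL)
  have h2 : 0 < min lam Lam := lt_min hl hL
  have h3 := (hm r hr).2
  have : 0 ≤ min lam⁻¹ Lam⁻¹ * min lam Lam * (k / r) * p r ^ 2 := by positivity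
  linarith

lemma energy_zero (h : Sol lam Lam k g ξ R u p q) :
    energy lam Lam g u p 0 = prim (force lam Lam g) ξ := by
  simp [energy, h.u0, h.p0]

/-- The energy of a nonconstant solution drops at once: otherwise the damping, hence the speed,
would vanish near `r = 0`, and `ξ` would be an equilibrium. -/
lemma energy_lt (hl : 0 < lam) (hL : 0 < Lam) (hk : 0 < k) (hg : Continuous g)
    (h : Sol lam Lam k g ξ R u p q) (hξ : g ξ ≠ 0) {r : ℝ} (hr : r ∈ dom R) (h0 : 0 < r) :
    energy lam Lam g u p r < energy lam Lam g u p 0 := by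
  have hanti := h.antitoneOn_energy hl hL hk.le hg
  have hz := zero_mem_dom h.pos
  refine lt_of_le_of_ne (hanti hz hr h0.le) fun heq => hξ ?_
  have hconst : ∀ s ∈ Icc 0 r, energy lam Lam g u p s = energy lam Lam g u p 0 := fun s hs =>
    le_antisymm (hanti hz (Icc_subset_dom hr hs) hs.1)
      (heq.symm.le.trans (hanti (Icc_subset_dom hr hs) hr hs.2))
  have hm : ∀ s ∈ Ioo 0 r, s ∈ dom R := fun s hs => Icc_subset_dom hr (Ioo_subset_Icc_self hs)
  have hp : ∀ s ∈ Ioo 0 r, p s = 0 := by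
    intro s hs
    have h1 : HasDerivAt (energy lam Lam g u p) 0 s := by
      refine (hasDerivAt_const s (energy lam Lam g u p 0)).congr_of_eventuallyEq ?_
      filter_upwards [Icc_mem_nhds hs.1 hs.2] with x hx using hconst x hx
    have h2 := h.mul_add_force_le hl hL hk.le (hm s hs) hs.1
    rw [(h.hasDerivAt_energy hl hL hg (hm s hs) hs.1).unique h1] at h2
    have h3 : 0 < min lam⁻¹ Lam⁻¹ * min lam Lam * (k / s) :=
      mul_pos (mul_pos (lt_min (inv_pos.mpr hl) (inv_pos.mpr hL)) (lt_min hl hL))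
        (div_pos hk hs.1)
    have : p s ^ 2 ≤ 0 := by
      by_contra! h4
      nlinarith [mul_pos h3 h4]
    exact pow_eq_zero_iff two_ne_zero |>.mp (le_antisymm this (sq_nonneg _))
  have hs : r / 2 ∈ Ioo 0 r := ⟨half_pos h0, half_lt_self h0⟩
  have hq : q (r / 2) = 0 := by
    refine (h.hasDerivAt_p (hm _ hs) hs.1).unique ?_
    refine (hasDerivAt_const (r / 2) (0 : ℝ)).congr_of_eventuallyEq ?_
    filter_upwards [Ioo_mem_nhds hs.1 hs.2] with x hx using hp x hx
  have hu : u (r / 2) = ξ := by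
    have h1 := abs_le_add_mul_of_deriv (f := fun x => u x - ξ) (f' := p) (a := 0) (b := r / 2)
      (A := 0) (C := 0) hs.1.le le_rfl
      ((h.continuousOn_u.mono (Icc_subset_dom (hm _ hs))).sub continuousOn_const)
      (fun x hx => (h.hasDerivAt_u (hm x ⟨hx.1, hx.2.trans hs.2⟩) hx.1).sub_const ξ)
      (by simp [h.u0]) (fun x hx _ => (hp x ⟨hx.1, hx.2.trans hs.2⟩).le)
      (fun x hx _ => by rw [hp x ⟨hx.1, hx.2.trans hs.2⟩, neg_zero])
    simp only [zero_mul, add_zero, abs_nonpos_iff] at h1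
    linarith
  have := (accel_eq_iff hl hL).mp (h.eqn _ (hm _ hs) hs.1)
  rw [hq, hp _ hs, hu] at this
  simpa using this

/-- A solution whose energy is below the two potential barriers at `±β` remains in `[-β, β]`. -/
lemma abs_le_of_energy_lt (hl : 0 < lam) (hL : 0 < Lam) (hg : Continuous g)
    (hodd : Function.Odd g) (hpos : ∀ s : ℝ, 0 < s → (s : EReal) < α → 0 < g s)
    (h : Sol lam Lam k g ξ R u p q) {β r₀ : ℝ} (hβ : 0 ≤ β) (hβα : (β : EReal) < α)
    (hr₀ : 0 ≤ r₀) (hu₀ : |u r₀| ≤ β)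
    (hE : ∀ r ∈ dom R, r₀ < r → energy lam Lam g u p r < lam⁻¹ * prim g β ∧
      energy lam Lam g u p r < Lam⁻¹ * prim g β) :
    ∀ r ∈ dom R, r₀ ≤ r → |u r| ≤ β := by
  intro r hr hr₀r
  by_contra! hcon
  obtain ⟨x, hx1, hx2⟩ := EReal.lt_iff_exists_real_btwn.mp hβα
  -- a level slightly above `β`, still below `α`, which `|u|` reaches after `r₀`
  set b := min x |u r| with hb
  have hβb : β < b := lt_min (by exact_mod_cast hx1) hcon
  have hbα : (b : EReal) < α := (EReal.coe_le_coe_iff.mpr (min_le_left _ _)).trans_lt hx2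
  have hsub : Icc r₀ r ⊆ dom R := fun s hs => mem_dom_of_le hr (hr₀.trans hs.1) hs.2
  obtain ⟨s, hs, hus⟩ := intermediate_value_Icc hr₀r (h.continuousOn_u.abs.mono hsub)
    ⟨hu₀.trans hβb.le, min_le_right _ _⟩
  have hs₀ : r₀ < s := by
    rcases hs.1.lt_or_eq with h1 | rfl
    · exact h1
    · simp only at hus; linarith
  have hgpos : ∀ t ∈ Icc 0 b, 0 ≤ g t := by
    intro t ht
    rcases ht.1.lt_or_eq with h1 | rfl
    · exact (hpos t h1 ((EReal.coe_le_coe_iff.mpr ht.2).trans_lt hbα)).le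
    · exact hodd.map_zero.ge
  have hG : prim g β ≤ prim g b := by
    refine (strictMonoOn_prim hg (a := 0) (b := b) fun t ht => ?_).monotoneOn ⟨hβ, hβb.le⟩
      ⟨hβ.trans hβb.le, le_rfl⟩ hβb.le
    exact hpos t ht.1 ((EReal.coe_lt_coe_iff.mpr ht.2).trans hbα)
  have hb0 : 0 ≤ b := hβ.trans hβb.le
  obtain ⟨e1, e2⟩ := hE s (hsub hs) hs₀
  have hlow : prim (force lam Lam g) (u s) ≤ energy lam Lam g u p s := by
    have := sq_nonneg (p s)
    rw [energy]; linarith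
  simp only at hus
  rcases abs_choice (u s) with h1 | h1
  · rw [h1] at hus
    rw [hus, prim_force_of_nonneg hb0 hgpos] at hlow
    have := mul_le_mul_of_nonneg_left hG (inv_pos.mpr hl).le
    linarith
  · rw [h1] at hus
    rw [show u s = -b by linarith, prim_force_neg_of_nonneg hodd hb0 hgpos] at hlow
    have := mul_le_mul_of_nonneg_left hG (inv_pos.mpr hL).le
    linarith

end Sol
end

/-! ### Oscillation and decay -/

/-- Oscillation: without zeros, the angle `arctan (u' / u)` would decrease at a definite rate. -/
lemma exists_zero_of_mul_deriv2_le {u p q : ℝ → ℝ} {a m C : ℝ} (ha : 0 < a) (hm : 0 < m)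
    (hC : 0 ≤ C) (hu : ∀ r, a < r → HasDerivAt u (p r) r) (hp : ∀ r, a < r → HasDerivAt p (q r) r)
    (hq : ∀ r, a < r → u r * q r ≤ -(m * u r ^ 2) + C / r * |p r| * |u r|) :
    ∃ r, a < r ∧ u r = 0 := by
  by_contra! hne
  set μ := min m 1 / 2 with hμ_def
  have hμ : 0 < μ := by have := lt_min hm one_pos; positivity
  have hμm : 2 * μ ≤ m := by rw [hμ_def]; linarith [min_le_left m 1]
  have hμ1 : 2 * μ ≤ 1 := by rw [hμ_def]; linarith [min_le_right m 1]
  set b := a + 1 + C / μ with hb_def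
  have hab : a < b := by
    have : 0 ≤ C / μ := by positivity
    linarith
  set c := b + 4 / μ with hc_def
  have hbc : b ≤ c := by
    have : 0 < 4 / μ := by positivity
    linarith
  have hder : ∀ r, a < r → HasDerivAt (fun r => Real.arctan (p r / u r) + μ * r)
      (1 / (1 + (p r / u r) ^ 2) * ((q r * u r - p r * p r) / u r ^ 2) + μ * 1) r := fun r hr =>
    (((hp r hr).div (hu r hr) (hne r hr)).arctan).add ((hasDerivAt_id r).const_mul μ)
  have hanti := antitoneOn_Icc_of_hasDerivAt (a := b) (b := c)
    (fun r hr => (hder r (hab.trans_le hr.1)).continuousAt.continuousWithinAt)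
    (fun r hr => hder r (hab.trans hr.1)) (fun r hr => ?_) ⟨le_rfl, hbc⟩ ⟨hbc, le_rfl⟩ hbc
  · have h1 := Real.arctan_lt_pi_div_two (p b / u b)
    have h2 := Real.neg_pi_div_two_lt_arctan (p c / u c)
    have h3 : μ * c = μ * b + 4 := by rw [hc_def]; field_simp
    have h4 := Real.pi_lt_four
    simp only at hanti
    linarith
  · have har : a < r := hab.trans hr.1
    have hr0 : 0 < r := ha.trans har
    set w := p r / u r with hw
    have hur := hne r har
    have hw2 : (q r * u r - p r * p r) / u r ^ 2 ≤ -m + C / r * |w| - w ^ 2 := by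
      rw [div_le_iff₀ (by positivity)]
      have e1 : |w| * u r ^ 2 = |p r| * |u r| := by
        rw [hw, abs_div, ← sq_abs (u r)]
        have : |u r| ≠ 0 := abs_ne_zero.mpr hur
        field_simp
      have e2 : w ^ 2 * u r ^ 2 = p r * p r := by rw [hw]; field_simp
      have := hq r har
      have e3 : C / r * |w| * u r ^ 2 = C / r * |p r| * |u r| := by rw [mul_assoc, e1, ← mul_assoc]
      nlinarith
    have hCr : C / r ≤ μ := by
      rw [div_le_iff₀ hr0]
      have : μ * (C / μ) ≤ μ * r := mul_le_mul_of_nonneg_left (by linarith [hr.1]) hμ.le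
      rwa [mul_div_cancel₀ _ hμ.ne'] at this
    have hw1 : 2 * |w| ≤ 1 + w ^ 2 := by nlinarith [sq_nonneg (|w| - 1), sq_abs w]
    have h5 : (q r * u r - p r * p r) / u r ^ 2 ≤ -(μ * (1 + w ^ 2)) := by
      refine hw2.trans ?_
      have := mul_le_mul_of_nonneg_right hCr (abs_nonneg w)
      nlinarith [sq_nonneg w]
    have h6 : 0 < 1 + w ^ 2 := by positivity
    rw [one_div, inv_mul_eq_div, mul_one, div_add' _ _ _ h6.ne']
    refine div_nonpos_of_nonpos_of_nonneg (by linarith) h6.le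

/-- Decay of the energy. Here `E` is at most a multiple of `u² + u'²` and is dissipated at the
rate `u'² / r` only, but the corrected energy `E + (ε / r) u u'` is dissipated at a rate comparable to `E / r`,
which is not integrable at infinity. -/
lemma tendsto_energy_zero {u p q E E' : ℝ → ℝ} {a m L c C β P : ℝ} (ha : 0 < a) (hm : 0 < m)
    (hc : 0 < c) (hC : 0 ≤ C)
    (hu : ∀ r, a ≤ r → HasDerivAt u (p r) r) (hp : ∀ r, a ≤ r → HasDerivAt p (q r) r)
    (hE : ∀ r, a ≤ r → HasDerivAt E (E' r) r)
    (hub : ∀ r, a ≤ r → |u r| ≤ β) (hpb : ∀ r, a ≤ r → |p r| ≤ P)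
    (hq : ∀ r, a ≤ r → u r * q r ≤ -(m * u r ^ 2) + C / r * |p r| * |u r|)
    (hE' : ∀ r, a ≤ r → E' r ≤ -(c / r * p r ^ 2))
    (hE0 : ∀ r, a ≤ r → 0 ≤ E r) (hEle : ∀ r, a ≤ r → E r ≤ p r ^ 2 / 2 + L * u r ^ 2 / 2) :
    Tendsto E atTop (𝓝 0) := by
  have hanti : ∀ x y, a ≤ x → x ≤ y → E y ≤ E x := fun x y hx hxy =>
    antitoneOn_Icc_of_hasDerivAt
      (fun r hr => (hE r (hx.trans hr.1)).continuousAt.continuousWithinAt)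
      (fun r hr => hE r (hx.trans hr.1.le)) (fun r hr => (hE' r (hx.trans hr.1.le)).trans (by
        have : 0 < r := ha.trans_le (hx.trans hr.1.le)
        have : 0 ≤ c / r * p r ^ 2 := by positivity
        linarith)) ⟨le_rfl, hxy⟩ ⟨hxy, le_rfl⟩ hxy
  have hsmall : ∀ e > 0, ∃ r, a ≤ r ∧ E r < e := by
    intro e he
    by_contra! hge
    have hβ : 0 ≤ β := (abs_nonneg _).trans (hub a le_rfl)
    have hP : 0 ≤ P := (abs_nonneg _).trans (hpb a le_rfl)
    set ε := c / 2 with hε_def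
    have hε : 0 < ε := by positivity
    set D := ε * (C + 1) * (P * β) with hD_def
    have hD : 0 ≤ D := by positivity
    set κ := max 1 (L / m) with hκ_def
    have hκ : 0 < κ := lt_max_of_lt_left one_pos
    set δ := ε * (2 * e / κ) with hδ_def
    have hδ : 0 < δ := by positivity
    -- the corrected energy, plus a primitive of the negative of the bound for its derivative
    let V : ℝ → ℝ := fun r => E r + ε / r * (u r * p r) + (δ * Real.log r + D / r)
    have hVder : ∀ r, a ≤ r → HasDerivAt V (E' r + (-ε / r ^ 2 * (u r * p r) +
        ε / r * (p r * p r + u r * q r)) + (δ * r⁻¹ + -D / r ^ 2)) r := by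
      intro r hr
      have hr0 : r ≠ 0 := (ha.trans_le hr).ne'
      have h1 : ∀ x : ℝ, HasDerivAt (fun r : ℝ => x / r) (-x / r ^ 2) r := fun x =>
        (((hasDerivAt_id r).fun_inv hr0).const_mul x).congr_deriv (by simp; ring)
      exact ((hE r hr).add ((h1 ε).mul ((hu r hr).mul (hp r hr)))).add
        (((Real.hasDerivAt_log hr0).const_mul δ).add (h1 D))
    have hVanti : ∀ y, a ≤ y → V y ≤ V a := fun y hy => by
      refine antitoneOn_Icc_of_hasDerivAt
        (fun r hr => (hVder r hr.1).continuousAt.continuousWithinAt)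
        (fun r hr => hVder r hr.1.le) (fun r hr => ?_) ⟨le_rfl, hy⟩ ⟨hy, le_rfl⟩ hy
      have hra : a ≤ r := hr.1.le
      have hr0 : 0 < r := ha.trans_le hra
      set X := |p r| * |u r| with hX
      have hXle : X ≤ P * β := mul_le_mul (hpb r hra) (hub r hra) (abs_nonneg _) hP
      have e1 : -(u r * p r) ≤ X := by
        rw [hX, ← abs_mul, mul_comm (p r)]; exact neg_le_abs _
      have e2 : E r ≤ κ * (p r ^ 2 + m * u r ^ 2) / 2 := by
        refine (hEle r hra).trans ?_
        have k1 : p r ^ 2 ≤ κ * p r ^ 2 :=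
          le_mul_of_one_le_left (sq_nonneg _) (le_max_left _ _)
        have k2 : L * u r ^ 2 ≤ κ * (m * u r ^ 2) := by
          have : L ≤ κ * m := by
            rw [← div_le_iff₀ hm]; exact le_max_right _ _
          nlinarith [sq_nonneg (u r)]
        linarith
      have e3 : 2 * e / κ ≤ p r ^ 2 + m * u r ^ 2 := by
        rw [div_le_iff₀ hκ]; linarith [hge r hra]
      have e4 := mul_le_mul_of_nonneg_left e3 hε.le
      have h1 := hE' r hra
      have h2 : ε / r * (p r * p r + u r * q r) ≤
          ε / r * (p r ^ 2 + (-(m * u r ^ 2) + C / r * X)) := by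
        refine mul_le_mul_of_nonneg_left ?_ (by positivity)
        have := hq r hra
        rw [mul_assoc, ← hX] at this
        nlinarith
      have h3 : -ε / r ^ 2 * (u r * p r) ≤ ε / r ^ 2 * X := by
        rw [neg_div, neg_mul, ← mul_neg]
        exact mul_le_mul_of_nonneg_left e1 (by positivity)
      have h4 : ε * (C + 1) * X ≤ D := mul_le_mul_of_nonneg_left hXle (by positivity)
      have h5 : E' r + (-ε / r ^ 2 * (u r * p r) + ε / r * (p r * p r + u r * q r)) +
          (δ * r⁻¹ + -D / r ^ 2) ≤ (δ - ε * (p r ^ 2 + m * u r ^ 2)) / r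
            + (ε * (C + 1) * X - D) / r ^ 2 := by
        refine (add_le_add_left (add_le_add h1 (add_le_add h3 h2)) _).trans (le_of_eq ?_)
        rw [hε_def]
        field_simp
        ring
      refine h5.trans (add_nonpos (div_nonpos_of_nonpos_of_nonneg (by linarith) hr0.le)
        (div_nonpos_of_nonpos_of_nonneg (by linarith) (by positivity)))
    obtain ⟨y, hy1, hy2⟩ := ((Real.tendsto_log_atTop.eventually_gt_atTop
      ((V a + ε / a * (P * β)) / δ)).and (eventually_ge_atTop a)).exists
    have hy0 : 0 < y := ha.trans_le hy2
    have h1 := hVanti y hy2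
    rw [div_lt_iff₀ hδ] at hy1
    have h2 : -(ε / a * (P * β)) ≤ ε / y * (u y * p y) := by
      have k1 : |ε / y * (u y * p y)| ≤ ε / a * (P * β) := by
        rw [abs_mul, abs_mul, abs_of_pos (div_pos hε hy0), mul_comm |u y|]
        have := hpb y hy2
        have := hub y hy2
        gcongr
      linarith [neg_abs_le (ε / y * (u y * p y))]
    have h3 : 0 ≤ D / y := by positivity
    have h4 := hE0 y hy2
    simp only [V] at h1 hy1
    linarith
  rw [Metric.tendsto_atTop]
  intro e he
  obtain ⟨r, hr, hEr⟩ := hsmall e he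
  refine ⟨r, fun y hy => ?_⟩
  rw [Real.dist_eq, sub_zero, abs_of_nonneg (hE0 y (hr.trans hy))]
  exact (hanti r y hr hy).trans_lt hEr

section
variable {lam Lam k : ℝ} {g : ℝ → ℝ} {ξ : ℝ} {R α : EReal} {u p q : ℝ → ℝ}

/-- By the derivative at the origin and compactness, `g` is bounded below by a linear function on
compact subsets of `[0, α)`. -/
lemma exists_mul_le_of_pos (hg : Continuous g) (hg0 : g 0 = 0)
    (hd : DifferentiableAt ℝ g 0) (hd0 : 0 < deriv g 0)
    (hpos : ∀ s : ℝ, 0 < s → (s : EReal) < α → 0 < g s) {β : ℝ} (hβ : 0 ≤ β)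
    (hβα : (β : EReal) < α) : ∃ m > 0, ∀ s ∈ Icc 0 β, m * s ≤ g s := by
  have hc : ContinuousOn (dslope g 0) (Icc 0 β) := by
    intro s _
    refine ContinuousAt.continuousWithinAt ?_
    rcases eq_or_ne s 0 with rfl | hs
    · exact continuousAt_dslope_same.mpr hd
    · exact (continuousAt_dslope_of_ne hs).mpr hg.continuousAt
  obtain ⟨x, hx, hmin⟩ := isCompact_Icc.exists_isMinOn ⟨0, le_rfl, hβ⟩ hc
  refine ⟨dslope g 0 x, ?_, fun s hs => ?_⟩
  · rcases hx.1.lt_or_eq with h | rfl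
    · rw [dslope_of_ne _ h.ne', slope_def_field, hg0, sub_zero, sub_zero]
      exact div_pos (hpos x h ((EReal.coe_le_coe_iff.mpr hx.2).trans_lt hβα)) h
    · rwa [dslope_same]
  · rcases hs.1.lt_or_eq with h | rfl
    · have := hmin hs
      rw [mem_ofPred_eq, dslope_of_ne _ h.ne', slope_def_field g, hg0, sub_zero, sub_zero,
        le_div_iff₀ h] at this
      exact this
    · simp [hg0]

lemma mul_sq_le_prim {m β : ℝ} (hg : Continuous g) (h : ∀ s ∈ Icc 0 β, m * s ≤ g s) :
    ∀ s ∈ Icc 0 β, m * s ^ 2 / 2 ≤ prim g s := by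
  intro s hs
  have := antitoneOn_Icc_of_hasDerivAt (f := fun s => m * s ^ 2 / 2 - prim g s)
    (f' := fun s => m * s - g s) (a := 0) (b := s)
    (by have := continuous_prim hg; fun_prop)
    (fun x _ => (((((hasDerivAt_id x).pow 2).const_mul m).div_const 2).sub
      (hasDerivAt_prim hg x)).congr_deriv (by simp; ring))
    (fun x hx => by linarith [h x ⟨hx.1.le, hx.2.le.trans hs.2⟩])
    ⟨le_rfl, hs.1⟩ ⟨hs.1, le_rfl⟩ hs.1
  simp only [prim_zero] at this
  linarith

/-- A bounded global solution oscillates and decays, together with its first two derivatives. -/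
lemma Sol.oscillating_and_tendsto (hl : 0 < lam) (hL : 0 < Lam) (hk : 0 < k)
    (hg : LocallyLipschitz g) (hodd : Function.Odd g) (hd : DifferentiableAt ℝ g 0)
    (hd0 : 0 < deriv g 0) (hpos : ∀ s : ℝ, 0 < s → (s : EReal) < α → 0 < g s)
    (h : Sol lam Lam k g ξ ⊤ u p q) {β : ℝ} (hβ : 0 ≤ β) (hβα : (β : EReal) < α)
    (hub : ∀ r, 0 ≤ r → |u r| ≤ β) :
    IsOscillating u ∧ Tendsto u atTop (𝓝 0) ∧ Tendsto p atTop (𝓝 0) ∧ Tendsto q atTop (𝓝 0) := by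
  have hgc := hg.continuous
  have hg0 : g 0 = 0 := hodd.map_zero
  obtain ⟨m₀, hm₀, hmg⟩ := exists_mul_le_of_pos hgc hg0 hd hd0 hpos hβ hβα
  obtain ⟨L₀, hL₀, hLg⟩ := exists_abs_sub_le_of_locallyLipschitz hg β
  have hgL : ∀ s ∈ Icc 0 β, g s ≤ L₀ * s := fun s hs => by
    have := hLg s ⟨by linarith [hs.1], hs.2⟩ 0 ⟨by linarith, hβ⟩
    rw [hg0, sub_zero, sub_zero, abs_of_nonneg hs.1] at this
    exact (le_abs_self _).trans this
  have hgnn : ∀ s ∈ Icc 0 β, 0 ≤ g s := fun s hs =>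
    (mul_nonneg hm₀.le hs.1).trans (hmg s hs)
  set i := min lam⁻¹ Lam⁻¹ with hi_def
  set j := max lam⁻¹ Lam⁻¹ with hj_def
  have hi : 0 < i := lt_min (inv_pos.mpr hl) (inv_pos.mpr hL)
  have hj : 0 < j := lt_max_of_lt_left (inv_pos.mpr hl)
  set m := i * m₀ with hm_def
  set L := j * (L₀ + 1) with hL_def
  have hm : 0 < m := by positivity
  -- quadratic bounds, first for `|s|`, then transferred to the force and the potential
  have hfs : ∀ s, |s| ≤ β → m * s ^ 2 ≤ s * force lam Lam g s ∧ |force lam Lam g s| ≤ L * |s| ∧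
      m * s ^ 2 / 2 ≤ prim (force lam Lam g) s ∧
      prim (force lam Lam g) s ≤ L * s ^ 2 / 2 := by
    have aux : ∀ t, ∀ s ∈ Icc 0 β, i ≤ t → t ≤ j → m * s ^ 2 ≤ s * (t * g s) ∧
        t * g s ≤ L * s ∧ m * s ^ 2 / 2 ≤ t * prim g s ∧ t * prim g s ≤ L * s ^ 2 / 2 := by
      intro t s hs hit htj
      have h1 := hmg s hs
      have h2 := hgL s hs
      have h3 := mul_sq_le_prim hgc hmg s hs
      have h4 := mul_sq_le_prim (g := fun s => -g s) (m := -L₀) hgc.neg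
        (fun s hs => by linarith [hgL s hs]) s hs
      have h5 : prim (fun s => -g s) s = -prim g s := intervalIntegral.integral_neg
      rw [h5] at h4
      have ht : 0 < t := hi.trans_le hit
      have hs0 := hs.1
      refine ⟨?_, ?_, ?_, ?_⟩
      · have k1 : m * s ≤ t * g s := by
          calc m * s = i * (m₀ * s) := by rw [hm_def]; ring
            _ ≤ t * g s := mul_le_mul hit h1 (by positivity) ht.le
        nlinarith [mul_le_mul_of_nonneg_left k1 hs0]
      · calc t * g s ≤ j * ((L₀ + 1) * s) := mul_le_mul htj (by linarith) (hgnn s hs) hj.le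
          _ = L * s := by rw [hL_def]; ring
      · calc m * s ^ 2 / 2 = i * (m₀ * s ^ 2 / 2) := by rw [hm_def]; ring
          _ ≤ t * prim g s := mul_le_mul hit h3 (by positivity) ht.le
      · calc t * prim g s ≤ j * ((L₀ + 1) * s ^ 2 / 2) :=
              mul_le_mul htj (by nlinarith [sq_nonneg s])
                ((by positivity : 0 ≤ m₀ * s ^ 2 / 2).trans h3) hj.le
          _ = L * s ^ 2 / 2 := by rw [hL_def]; ring
    intro s hs
    rcases le_total 0 s with h0 | h0
    · have hsI : s ∈ Icc 0 β := ⟨h0, (le_abs_self s).trans hs⟩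
      obtain ⟨a1, a2, a3, a4⟩ := aux lam⁻¹ s hsI (min_le_left _ _) (le_max_left _ _)
      rw [force_of_nonneg (hgnn s hsI), prim_force_of_nonneg h0 fun x hx =>
        hgnn x ⟨hx.1, hx.2.trans hsI.2⟩, abs_of_nonneg h0,
        abs_of_nonneg (mul_nonneg (inv_pos.mpr hl).le (hgnn s hsI))]
      exact ⟨a1, a2, a3, a4⟩
    · obtain ⟨t, rfl⟩ : ∃ t, s = -t := ⟨-s, by ring⟩
      have ht : 0 ≤ t := by linarith
      have hsI : t ∈ Icc 0 β := ⟨ht, by rwa [abs_neg, abs_of_nonneg ht] at hs⟩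
      obtain ⟨a1, a2, a3, a4⟩ := aux Lam⁻¹ t hsI (min_le_right _ _) (le_max_right _ _)
      rw [force_neg_of_nonneg hodd (hgnn t hsI), prim_force_neg_of_nonneg hodd ht fun x hx =>
        hgnn x ⟨hx.1, hx.2.trans hsI.2⟩, abs_neg, abs_neg, abs_of_nonneg ht,
        abs_of_nonneg (mul_nonneg (inv_pos.mpr hL).le (hgnn t hsI)), neg_sq, neg_mul_neg]
      exact ⟨a1, a2, a3, a4⟩
  have hdom : ∀ r, 0 ≤ r → r ∈ dom ⊤ := fun r hr => by rw [dom_top]; exact hr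
  set C := j * max lam Lam * k with hC_def
  have hC : 0 ≤ C := by
    have : 0 < max lam Lam := lt_max_of_lt_left hl
    positivity
  have hqf : ∀ r, 0 < r → |q r + force lam Lam g (u r)| ≤ C / r * |p r| := fun r hr =>
    h.abs_add_force_le hl hL hk.le (hdom r hr.le) hr
  have hu : ∀ r, 0 < r → HasDerivAt u (p r) r := fun r hr => h.hasDerivAt_u (hdom r hr.le) hr
  have hp : ∀ r, 0 < r → HasDerivAt p (q r) r := fun r hr => h.hasDerivAt_p (hdom r hr.le) hr
  have huq : ∀ r, 0 < r → u r * q r ≤ -(m * u r ^ 2) + C / r * |p r| * |u r| := by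
    intro r hr
    have h1 := (hfs (u r) (hub r hr.le)).1
    have h2 := mul_le_mul_of_nonneg_right (hqf r hr) (abs_nonneg (u r))
    rw [← abs_mul] at h2
    have h3 := (le_abs_self _).trans h2
    nlinarith
  have hElow : ∀ r, 0 ≤ r →
      p r ^ 2 / 2 + m * u r ^ 2 / 2 ≤ energy lam Lam g u p r := fun r hr => by
    rw [energy]; linarith [(hfs (u r) (hub r hr)).2.2.1]
  have hE0 : ∀ r, 0 ≤ r → 0 ≤ energy lam Lam g u p r := fun r hr =>
    (by positivity : 0 ≤ p r ^ 2 / 2 + m * u r ^ 2 / 2).trans (hElow r hr)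
  have hanti := h.antitoneOn_energy hl hL hk.le hgc
  have hpb : ∀ r, 0 ≤ r → |p r| ≤ √(2 * energy lam Lam g u p 0) := fun r hr => by
    refine Real.abs_le_sqrt ?_
    have h1 := hanti (hdom 0 le_rfl) (hdom r hr) hr
    have h2 : 0 ≤ m * u r ^ 2 := by positivity
    linarith [hElow r hr]
  have hElim : Tendsto (energy lam Lam g u p) atTop (𝓝 0) :=
    tendsto_energy_zero (a := 1) (L := L) (c := i * min lam Lam * k) one_pos hm
      (mul_pos (mul_pos hi (lt_min hl hL)) hk) hC
      (fun r hr => hu r (one_pos.trans_le hr)) (fun r hr => hp r (one_pos.trans_le hr))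
      (fun r hr => h.hasDerivAt_energy hl hL hgc (hdom r (zero_le_one.trans hr))
        (one_pos.trans_le hr))
      (fun r hr => hub r (zero_le_one.trans hr)) (fun r hr => hpb r (zero_le_one.trans hr))
      (fun r hr => huq r (one_pos.trans_le hr))
      (fun r hr => (h.mul_add_force_le hl hL hk.le (hdom r (zero_le_one.trans hr))
        (one_pos.trans_le hr)).trans (le_of_eq (by ring)))
      (fun r hr => hE0 r (zero_le_one.trans hr))
      (fun r hr => by
        rw [energy]; linarith [(hfs (u r) (hub r (zero_le_one.trans hr))).2.2.2])
  have hsqrt : ∀ c : ℝ, Tendsto (fun r => √(c * energy lam Lam g u p r)) atTop (𝓝 0) := fun c => by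
    simpa using (hElim.const_mul c).sqrt
  have hulim : Tendsto u atTop (𝓝 0) := by
    refine squeeze_zero_norm' ?_ (hsqrt (2 / m))
    filter_upwards [eventually_ge_atTop 0] with r hr
    refine Real.abs_le_sqrt ?_
    have h1 := hElow r hr
    rw [div_mul_eq_mul_div, le_div_iff₀ hm]
    nlinarith [sq_nonneg (p r)]
  have hplim : Tendsto p atTop (𝓝 0) := by
    refine squeeze_zero_norm' ?_ (hsqrt 2)
    filter_upwards [eventually_ge_atTop 0] with r hr
    refine Real.abs_le_sqrt ?_
    have h1 := hElow r hr
    nlinarith [sq_nonneg (u r)]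
  refine ⟨?_, hulim, hplim, ?_⟩
  · have hz : ∀ n : ℕ, ∃ r : ℝ, (n : ℝ) + 1 < r ∧ u r = 0 := fun n => by
      have hn : (0 : ℝ) < n + 1 := by positivity
      exact exists_zero_of_mul_deriv2_le hn hm hC (fun r hr => hu r (hn.trans hr))
        (fun r hr => hp r (hn.trans hr)) (fun r hr => huq r (hn.trans hr))
    choose z hz1 hz2 using hz
    refine ⟨z, fun n => ⟨?_, hz2 n⟩, ?_⟩
    · have : (0 : ℝ) ≤ n := n.cast_nonneg
      linarith [hz1 n]
    · rintro ⟨b, hb⟩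
      obtain ⟨n, hn⟩ := exists_nat_gt b
      linarith [hz1 n, hb (mem_range_self n)]
  · have hlim : Tendsto (fun r => L * |u r| + C * |p r|) atTop (𝓝 0) := by
      simpa using (hulim.abs.const_mul L).add (hplim.abs.const_mul C)
    refine squeeze_zero_norm' ?_ hlim
    filter_upwards [eventually_ge_atTop 1] with r hr
    have hr0 : 0 < r := one_pos.trans_le hr
    have h1 := hqf r hr0
    have h2 := (hfs (u r) (hub r hr0.le)).2.1
    have h3 : C / r * |p r| ≤ C * |p r| :=
      mul_le_mul_of_nonneg_right (div_le_self hC hr) (abs_nonneg _)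
    rw [Real.norm_eq_abs]
    have h4 := abs_sub_abs_le_abs_sub (q r) (-force lam Lam g (u r))
    rw [abs_neg, sub_neg_eq_add] at h4
    linarith

end

/-! ### The four regimes of initial values -/

lemma supNorm_le {u : ℝ → ℝ} {β : ℝ} (hβ : 0 ≤ β) (h : ∀ r, 0 ≤ r → |u r| ≤ β) :
    supNorm u ≤ (β : EReal) := by
  have h1 : eLpNorm u ⊤ (volume.restrict (Ici (0 : ℝ))) ≤ ENNReal.ofReal β := by
    rw [eLpNorm_exponent_top]
    refine eLpNormEssSup_le_of_ae_bound ?_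
    filter_upwards [ae_restrict_mem measurableSet_Ici] with r hr using h r hr
  rw [supNorm]
  refine (EReal.coe_ennreal_le_coe_ennreal_iff.mpr h1).trans ?_
  rw [EReal.coe_ennreal_ofReal, max_eq_left hβ]

lemma abs_le_supNorm {u : ℝ → ℝ} (hc : ContinuousWithinAt u (Ici 0) 0) :
    ((|u 0| : ℝ) : EReal) ≤ supNorm u := by
  have key : ‖u 0‖ₑ ≤ eLpNorm u ⊤ (volume.restrict (Ici (0 : ℝ))) := by
    by_contra! hlt
    have hev : ∀ᶠ r in 𝓝[≥] (0 : ℝ), eLpNorm u ⊤ (volume.restrict (Ici (0 : ℝ))) < ‖u r‖ₑ :=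
      hc.enorm.eventually_const_lt hlt
    obtain ⟨δ, hδ, hsub⟩ := mem_nhdsGE_iff_exists_Ico_subset.mp hev
    have hae : ∀ᵐ r ∂volume.restrict (Ici (0 : ℝ)), r ∉ Ico 0 δ := by
      filter_upwards [ae_le_eLpNormEssSup (f := u) (μ := volume.restrict (Ici (0 : ℝ)))]
        with r hr hm
      rw [← eLpNorm_exponent_top] at hr
      exact absurd (hsub hm) (not_lt.mpr hr)
    have hzero := measure_eq_zero_iff_ae_notMem.mpr hae
    rw [Measure.restrict_apply measurableSet_Ico, inter_eq_left.mpr Ico_subset_Ici_self,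
      Real.volume_Ico, sub_zero, ENNReal.ofReal_eq_zero] at hzero
    exact absurd hδ (not_lt.mpr hzero)
  rw [supNorm]
  refine le_trans ?_ (EReal.coe_ennreal_le_coe_ennreal_iff.mpr key)
  rw [← ofReal_norm, EReal.coe_ennreal_ofReal, Real.norm_eq_abs]
  exact EReal.coe_le_coe_iff.mpr (le_max_left |u 0| 0)

section
variable {lam Lam k : ℝ} {N : ℕ} {g : ℝ → ℝ} {ξ : ℝ} {R α : EReal} {u p q : ℝ → ℝ}

lemma sol_const (hξ : g ξ = 0) :
    Sol lam Lam k g ξ ⊤ (fun _ => ξ) (fun _ => 0) (fun _ => 0) where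
  pos := EReal.zero_lt_top
  hu _ _ := hasDerivWithinAt_const _ _ _
  hp _ _ := hasDerivWithinAt_const _ _ _
  hq := continuousOn_const
  u0 := rfl
  p0 := rfl
  eqn r _ _ := by rw [hξ]; simp [accel]

lemma SignCondition.map_eq_zero (hg : Continuous g) (h : SignCondition g α) {s : ℝ}
    (hs : (s : EReal) = α) : g s = 0 := by
  obtain ⟨h0, h1, h2⟩ := h
  have hs0 : 0 < s := by rw [← hs] at h0; exact_mod_cast h0
  apply le_antisymm
  · refine le_of_tendsto (hg.continuousAt.tendsto.mono_left (nhdsWithin_le_nhds (s := Ioi s))) ?_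
    filter_upwards [self_mem_nhdsWithin] with t ht
    exact (h2 t (hs ▸ EReal.coe_lt_coe_iff.mpr ht)).le
  · refine ge_of_tendsto (hg.continuousAt.tendsto.mono_left (nhdsWithin_le_nhds (s := Iio s))) ?_
    filter_upwards [Ioo_mem_nhdsLT hs0] with t ht
    exact (h1 t ht.1 (hs ▸ EReal.coe_lt_coe_iff.mpr ht.2)).le

namespace Sol

/-- The potential decreases beyond `α`, so that the energy prevents `u` from going below `ξ`. -/
lemma le_of_lt (hl : 0 < lam) (hL : 0 < Lam) (hk : 0 ≤ k) (hg : Continuous g)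
    (h : Sol lam Lam k g ξ R u p q) (hneg : ∀ s : ℝ, α < (s : EReal) → g s < 0)
    (hξ : α < (ξ : EReal)) {r : ℝ} (hr : r ∈ dom R) : ξ ≤ u r := by
  by_contra! hcon
  obtain ⟨x, hx1, hx2⟩ := EReal.lt_iff_exists_real_btwn.mp hξ
  -- a level slightly below `ξ`, still above `α`, which `u` reaches
  set b := max x (u r) with hb
  have hbξ : b < ξ := max_lt (by exact_mod_cast hx2) hcon
  have hαb : α < (b : EReal) := hx1.trans_le (EReal.coe_le_coe_iff.mpr (le_max_left _ _))
  obtain ⟨s, hs, hus⟩ := intermediate_value_Icc' hr.1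
    (h.continuousOn_u.mono (Icc_subset_dom hr)) ⟨le_max_right _ _, h.u0.symm ▸ hbξ.le⟩
  have h1 := h.antitoneOn_energy hl hL hk hg (zero_mem_dom h.pos) (Icc_subset_dom hr hs) hs.1
  rw [h.energy_zero, energy, hus] at h1
  have h2 := strictMonoOn_prim (g := fun s => -force lam Lam g s) (a := b) (b := ξ)
    (continuous_force hl hL hg).neg
    (fun t ht => neg_pos.mpr (pw_neg_of_neg (inv_pos.mpr hL)
      (hneg t (hαb.trans (EReal.coe_lt_coe_iff.mpr ht.1)))))
    ⟨le_rfl, hbξ.le⟩ ⟨hbξ.le, le_rfl⟩ hbξ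
  have h3 : ∀ t, prim (fun s => -force lam Lam g s) t = -prim (force lam Lam g) t :=
    fun t => intervalIntegral.integral_neg
  rw [h3, h3] at h2
  nlinarith [sq_nonneg (p s)]

/-- Barrier for the velocity: `ε r` is a subsolution of the first-order equation for `u'`
as long as `u` does not exceed `L`. -/
lemma exists_mul_le_deriv (hl : 0 < lam) (hL : 0 < Lam) (hk : 0 ≤ k) (hg : Continuous g)
    (h : Sol lam Lam k g ξ R u p q) (hneg : ∀ s : ℝ, α < (s : EReal) → g s < 0)
    (hξ : α < (ξ : EReal)) {L : ℝ} (hξL : ξ ≤ L) :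
    ∃ ε > 0, ∀ r ∈ dom R, (∀ s ∈ Icc 0 r, u s ≤ L) → ε * r ≤ p r := by
  obtain ⟨x, hx, hmax⟩ := isCompact_Icc.exists_isMaxOn ⟨ξ, le_rfl, hξL⟩ hg.continuousOn
  have hc : 0 < -g x :=
    neg_pos.mpr (hneg x (hξ.trans_le (EReal.coe_le_coe_iff.mpr hx.1)))
  set ε := -g x / (Lam * (1 + k)) with hε_def
  have hε : 0 < ε := by positivity
  refine ⟨ε, hε, fun r hr hub => ?_⟩
  have hm : ∀ s ∈ Ioo 0 r, s ∈ dom R := fun s hs => Icc_subset_dom hr (Ioo_subset_Icc_self hs)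
  have := le_add_mul_of_deriv_le (f := fun s => ε * s - p s) (f' := fun s => ε * 1 - q s)
    (A := 0) (C := 0) hr.1 le_rfl
    ((by fun_prop : ContinuousOn (fun s : ℝ => ε * s) (Icc 0 r)).sub
      (h.continuousOn_p.mono (Icc_subset_dom hr)))
    (fun s hs => ((hasDerivAt_id s).const_mul ε).sub (h.hasDerivAt_p (hm s hs) hs.1))
    (by simp [h.p0]) (fun s hs hlt => ?_)
  · linarith
  · have hs0 : 0 < s := hs.1
    have e1 : ε = accel lam Lam (k / s) (ε * s) (g x) := by
      rw [accel_eq_iff hl hL, pw_of_nonneg hε.le, pw_of_nonneg (by positivity), hε_def]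
      field_simp
      ring
    have e2 : g (u s) ≤ g x := hmax
      ⟨h.le_of_lt hl hL hk hg hneg hξ (hm s hs), hub s (Ioo_subset_Icc_self hs)⟩
    have e3 := accel_le_accel hl hL (div_nonneg hk hs0.le) (by linarith : p s ≤ ε * s) e2
    rw [← e1, ← h.eqn s (hm s hs) hs0] at e3
    linarith

lemma strictlyIncreasesToInfty (hl : 0 < lam) (hL : 0 < Lam) (hk : 0 ≤ k) (hg : Continuous g)
    (h : Sol lam Lam k g ξ R u p q) (hneg : ∀ s : ℝ, α < (s : EReal) → g s < 0)
    (hξ : α < (ξ : EReal)) (hξ0 : 0 < ξ)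
    (hmax : ∀ M, (∀ r ∈ dom R, |u r| ≤ M) → R = ⊤) : StrictlyIncreasesToInfty R u := by
  have hge : ∀ r ∈ dom R, ξ ≤ u r := fun r hr => h.le_of_lt hl hL hk hg hneg hξ hr
  have habs : ∀ r ∈ dom R, |u r| = u r := fun r hr => abs_of_pos (hξ0.trans_le (hge r hr))
  have hmono : StrictMonoOn (fun r => |u r|) (dom R) := by
    intro a ha b hb hab
    simp only [habs a ha, habs b hb]
    have hcont := h.continuousOn_u.mono (Icc_subset_dom hb)
    obtain ⟨x, hx, hxmax⟩ := isCompact_Icc.exists_isMaxOn ⟨b, hb.1, le_rfl⟩ hcont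
    obtain ⟨ε, hε, hbar⟩ := h.exists_mul_le_deriv hl hL hk hg hneg hξ
      (hge x (Icc_subset_dom hb hx))
    refine strictMonoOn_of_deriv_pos (convex_Icc 0 b) hcont (fun s hs => ?_) ⟨ha.1, hab.le⟩
      ⟨hb.1, le_rfl⟩ hab
    rw [interior_Icc] at hs
    have hsR := Icc_subset_dom hb (Ioo_subset_Icc_self hs)
    rw [(h.hasDerivAt_u hsR hs.1).deriv]
    exact (mul_pos hε hs.1).trans_le
      (hbar s hsR fun t ht => hxmax ⟨ht.1, ht.2.trans hs.2.le⟩)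
  refine ⟨hmono, fun M => ?_⟩
  by_contra! hcon
  have hbd : ∀ r ∈ dom R, |u r| ≤ M := fun r hr => by
    obtain ⟨s, hs, hrs, hsM⟩ := hcon r hr
    exact (hmono hr hs hrs).le.trans hsM
  obtain rfl := hmax M hbd
  have hdom : ∀ r, 0 ≤ r → r ∈ dom ⊤ := fun r hr => by rw [dom_top]; exact hr
  have hle : ∀ r, 0 ≤ r → u r ≤ M := fun r hr => (le_abs_self _).trans (hbd r (hdom r hr))
  have hξM : ξ ≤ M := h.u0 ▸ hle 0 le_rfl
  obtain ⟨ε, hε, hbar⟩ := h.exists_mul_le_deriv hl hL hk hg hneg hξ hξM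
  set r := 1 + 2 * M / ε with hr_def
  have hM0 : 0 < M := hξ0.trans_le hξM
  have hr1 : 1 ≤ r := by
    have : 0 ≤ 2 * M / ε := by positivity
    linarith
  have hr0 : 0 ≤ r := zero_le_one.trans hr1
  have := le_add_mul_of_deriv_le (f := fun s => ε * s ^ 2 / 2 - u s)
    (f' := fun s => ε * s - p s) (a := 0) (b := r) (A := -ξ) (C := 0) hr0 le_rfl
    ((by fun_prop : ContinuousOn (fun s : ℝ => ε * s ^ 2 / 2) (Icc 0 r)).sub
      (h.continuousOn_u.mono (Icc_subset_dom (hdom r hr0))))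
    (fun s hs => (((((hasDerivAt_id s).pow 2).const_mul ε).div_const 2).sub
      (h.hasDerivAt_u (hdom s hs.1.le) hs.1)).congr_deriv (by simp; ring))
    (by simp [h.u0])
    (fun s hs _ => by linarith [hbar s (hdom s hs.1.le) fun t ht => hle t ht.1])
  have h2 : ε * r = ε + 2 * M := by rw [hr_def]; field_simp
  have h3 : ε * r ≤ ε * r ^ 2 := mul_le_mul_of_nonneg_left (by nlinarith) hε.le
  linarith [hle r hr0]

end Sol

lemma lt_of_coe_mul_le {a b c : ℝ} (ha : 0 < a) (hbc : a * b < c) {x : EReal}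
    (h : (c : EReal) ≤ (a : EReal) * x) : (b : EReal) < x := by
  by_contra! hle
  have h1 : (a : EReal) * x ≤ (a : EReal) * (b : EReal) :=
    mul_le_mul_of_nonneg_left hle (by exact_mod_cast ha.le)
  have h2 := h.trans h1
  rw [← EReal.coe_mul, EReal.coe_le_coe_iff] at h2
  linarith

/-- `G` comes arbitrarily close to the value `G α` at arguments below `α`. -/
lemma exists_lt_prim (hg : Continuous g) {β₀ c : ℝ} (hβ₀ : (β₀ : EReal) < α)
    (hc : (c : EReal) < primAt g α) : ∃ β : ℝ, β₀ ≤ β ∧ (β : EReal) < α ∧ c < prim g β := by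
  rw [primAt] at hc
  split_ifs at hc with htop
  · have hfr := frequently_lt_of_lt_limsup (by isBoundedDefault) hc
    obtain ⟨β, h1, h2⟩ := (hfr.and_eventually (eventually_ge_atTop β₀)).exists
    exact ⟨β, h2, htop ▸ EReal.coe_lt_top β, by exact_mod_cast h1⟩
  · lift α to ℝ using ⟨htop, (bot_le.trans_lt hβ₀).ne'⟩
    rw [EReal.toReal_coe] at hc
    have hc' : c < prim g α := by exact_mod_cast hc
    have hβ' : β₀ < α := by exact_mod_cast hβ₀
    have hev : ∀ᶠ t in 𝓝[<] α, c < prim g t :=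
      ((continuous_prim hg).continuousAt.eventually_const_lt hc').filter_mono inf_le_left
    obtain ⟨β, h1, h2⟩ := (hev.and (Ioo_mem_nhdsLT hβ')).exists
    exact ⟨β, h2.1.le, by exact_mod_cast h2.2, h1⟩

/-- Positive initial values: the descent may amplify the potential energy by at most `Lam / lam`,
and the hypothesis on `G α` leaves room for that. -/
lemma Sol.exists_bound_of_pos (hl : 0 < lam) (hlL : lam ≤ Lam) (hk : 0 < k)
    (hg : Continuous g) (hodd : Function.Odd g)
    (hpos : ∀ s : ℝ, 0 < s → (s : EReal) < α → 0 < g s) (h : Sol lam Lam k g ξ R u p q)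
    (hξ0 : 0 < ξ) (hξα : (ξ : EReal) < α)
    (hG : (Lam : EReal) * (prim g ξ : EReal) ≤ (lam : EReal) * primAt g α) :
    ∃ β : ℝ, 0 ≤ β ∧ (β : EReal) < α ∧ ∀ r ∈ dom R, |u r| ≤ β := by
  have hL : 0 < Lam := hl.trans_le hlL
  have hξβ : ∀ t ∈ Icc 0 ξ, 0 ≤ g t := by
    intro t ht
    rcases ht.1.lt_or_eq with h1 | rfl
    · exact (hpos t h1 ((EReal.coe_le_coe_iff.mpr ht.2).trans_lt hξα)).le
    · exact hodd.map_zero.ge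
  obtain ⟨β₀, hβ1, hβ2⟩ := EReal.lt_iff_exists_real_btwn.mp hξα
  have hξβ₀ : ξ < β₀ := by exact_mod_cast hβ1
  -- an initial interval `[0, r₁]` on which `|u|` stays below `β₀`
  obtain ⟨r₁, hr₁0, hr₁, hub₁⟩ : ∃ r₁, 0 < r₁ ∧ r₁ ∈ dom R ∧ ∀ s ∈ Icc 0 r₁, |u s| ≤ β₀ := by
    have hz := zero_mem_dom h.pos
    have hc := (h.continuousOn_u 0 hz).abs
    have hev : ∀ᶠ s in 𝓝[dom R] 0, |u s| < β₀ :=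
      hc.eventually_lt_const (by simpa only [h.u0, abs_of_pos hξ0] using hξβ₀)
    have hev2 : {s | |u s| < β₀} ∩ dom R ∈ 𝓝[≥] (0 : ℝ) := by
      rw [← nhdsWithin_dom hz.2]
      exact inter_mem hev self_mem_nhdsWithin
    obtain ⟨δ, hδ, hsub⟩ := mem_nhdsGE_iff_exists_Ico_subset.mp hev2
    have hδ0 : 0 < δ := hδ
    refine ⟨δ / 2, half_pos hδ0, (hsub ⟨(half_pos hδ0).le, half_lt_self hδ0⟩).2, fun s hs => ?_⟩
    exact (hsub ⟨hs.1, hs.2.trans_lt (half_lt_self hδ0)⟩).1.le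
  have hE1 : energy lam Lam g u p r₁ < lam⁻¹ * prim g ξ := by
    rw [← prim_force_of_nonneg (lam := lam) (Lam := Lam) hξ0.le hξβ, ← h.energy_zero]
    exact h.energy_lt hl hL hk hg (hpos ξ hξ0 hξα).ne' hr₁ hr₁0
  set e := energy lam Lam g u p r₁ with he
  have hlt : lam * (Lam * e) < Lam * prim g ξ := by
    have h1 := mul_lt_mul_of_pos_left hE1 (mul_pos hl hL)
    have h2 : lam * Lam * (lam⁻¹ * prim g ξ) = Lam * prim g ξ := by field_simp
    linarith
  obtain ⟨β, hβ₀β, hβα, hβG⟩ := exists_lt_prim hg hβ2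
    (lt_of_coe_mul_le hl hlt (by rw [EReal.coe_mul]; exact hG))
  have hβ0 : 0 ≤ β := (hξ0.trans hξβ₀).le.trans hβ₀β
  have hmono : prim g ξ ≤ prim g β :=
    (strictMonoOn_prim hg (a := 0) (b := β) fun t ht =>
      hpos t ht.1 ((EReal.coe_lt_coe_iff.mpr ht.2).trans hβα)).monotoneOn
      ⟨hξ0.le, hξβ₀.le.trans hβ₀β⟩ ⟨hβ0, le_rfl⟩ (hξβ₀.le.trans hβ₀β)
  refine ⟨β, hβ0, hβα, fun r hr => ?_⟩
  rcases le_total r r₁ with h1 | h1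
  · exact (hub₁ r ⟨hr.1, h1⟩).trans hβ₀β
  · refine h.abs_le_of_energy_lt hl hL hg hodd hpos hβ0 hβα hr₁0.le
      ((hub₁ r₁ ⟨hr₁0.le, le_rfl⟩).trans hβ₀β) (fun s hs hs₁ => ?_) r hr h1
    have hes : energy lam Lam g u p s ≤ e := h.antitoneOn_energy hl hL hk.le hg hr₁ hs hs₁.le
    constructor
    · exact hes.trans_lt (hE1.trans_le (mul_le_mul_of_nonneg_left hmono (inv_pos.mpr hl).le))
    · refine hes.trans_lt ?_
      rw [inv_mul_eq_div, lt_div_iff₀ hL]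
      linarith

/-- Negative initial values: on both sides the potential barrier at `|ξ|` is at least the initial
energy. -/
lemma Sol.abs_le_of_neg (hl : 0 < lam) (hlL : lam ≤ Lam) (hk : 0 < k) (hg : Continuous g)
    (hodd : Function.Odd g) (hpos : ∀ s : ℝ, 0 < s → (s : EReal) < α → 0 < g s)
    (h : Sol lam Lam k g ξ R u p q) (hξ0 : ξ < 0) (hξα : ((-ξ : ℝ) : EReal) < α) :
    ∀ r ∈ dom R, |u r| ≤ -ξ := by
  have hL : 0 < Lam := hl.trans_le hlL
  have hη : 0 < -ξ := by linarith
  have hpos' : ∀ t ∈ Icc 0 (-ξ), 0 ≤ g t := by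
    intro t ht
    rcases ht.1.lt_or_eq with h1 | rfl
    · exact (hpos t h1 ((EReal.coe_le_coe_iff.mpr ht.2).trans_lt hξα)).le
    · exact hodd.map_zero.ge
  have hgξ : g ξ ≠ 0 := by
    have h1 := hpos _ hη hξα
    rw [hodd] at h1
    linarith
  have hE0 : energy lam Lam g u p 0 = Lam⁻¹ * prim g (-ξ) := by
    rw [h.energy_zero, ← prim_force_neg_of_nonneg (lam := lam) hodd hη.le hpos', neg_neg]
  have hG : 0 ≤ prim g (-ξ) := by
    rw [← prim_zero (g := g)]
    exact (strictMonoOn_prim hg (a := 0) (b := -ξ) fun t ht =>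
      hpos t ht.1 ((EReal.coe_lt_coe_iff.mpr ht.2).trans hξα)).monotoneOn
      ⟨le_rfl, hη.le⟩ ⟨hη.le, le_rfl⟩ hη.le
  intro r hr
  refine h.abs_le_of_energy_lt hl hL hg hodd hpos hη.le hξα le_rfl
    (by rw [h.u0, abs_of_neg hξ0]) (fun s hs hs0 => ?_) r hr hr.1
  have h1 := h.energy_lt hl hL hk hg hgξ hs hs0
  rw [hE0] at h1
  exact ⟨h1.trans_le (mul_le_mul_of_nonneg_right (inv_anti₀ hl hlL) hG), h1⟩

lemma Sol.isLocalized (h : Sol lam Lam k g ξ ⊤ u p q) (hu : Tendsto u atTop (𝓝 0))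
    (hp : Tendsto p atTop (𝓝 0)) (hq : Tendsto q atTop (𝓝 0)) : IsLocalized u := by
  have hdom : ∀ᶠ r : ℝ in atTop, r ∈ dom ⊤ := by
    filter_upwards [eventually_ge_atTop 0] with r hr
    rw [dom_top]; exact hr
  refine ⟨hu, hp.congr' ?_, hq.congr' ?_⟩
  · filter_upwards [hdom] with r hr using (h.d1_eq hr).symm
  · filter_upwards [hdom] with r hr using (h.d2_eq hr).symm

end
end PucciRadial

open PucciRadial in
theorem theorem3p1 (lam Lam : ℝ) (hlam : 0 < lam) (hLam : lam ≤ Lam) (N : ℕ) (hN : 2 ≤ N)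
    (g : ℝ → ℝ) (hg1 : LocallyLipschitz g) (hg2 : Function.Odd g)
    (α : EReal) (hg3 : PucciRadial.SignCondition g α)
    (hg4 : DifferentiableAt ℝ g 0 ∧ 0 < deriv g 0) (ξ : ℝ) :
    (∃ (R : EReal) (u : ℝ → ℝ), PucciRadial.IsMaximalSolution lam Lam N g ξ R u) ∧
    ∀ (R : EReal) (u : ℝ → ℝ), PucciRadial.IsMaximalSolution lam Lam N g ξ R u →
      (((|ξ| : ℝ) : EReal) = α ∨ ξ = 0 → ∀ r ∈ PucciRadial.dom R, u r = ξ) ∧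
      (α < ((|ξ| : ℝ) : EReal) → PucciRadial.StrictlyIncreasesToInfty R u) ∧
      (0 < ξ → (ξ : EReal) < α →
        (Lam : EReal) * (PucciRadial.prim g ξ : EReal) ≤ (lam : EReal) * PucciRadial.primAt g α →
        R = ⊤ ∧ PucciRadial.IsOscillating u ∧ PucciRadial.IsLocalized u ∧
          PucciRadial.supNorm u < α) ∧
      (-α < (ξ : EReal) → ξ < 0 →
        R = ⊤ ∧ PucciRadial.IsOscillating u ∧ PucciRadial.IsLocalized u ∧
          PucciRadial.supNorm u = ((-ξ : ℝ) : EReal) ∧ ((-ξ : ℝ) : EReal) < α) := by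
  have hL : 0 < Lam := hlam.trans_le hLam
  have hk : (0 : ℝ) < N - 1 := by
    have : (2 : ℝ) ≤ N := by exact_mod_cast hN
    linarith
  have hgc := hg1.continuous
  refine ⟨exists_isMaximalSolution hlam hL (by omega) hg1 ξ, fun R u hmax => ?_⟩
  have h := hmax.1.sol hlam hL
  have htop : ∀ M, (∀ r ∈ dom R, |u r| ≤ M) → R = ⊤ := fun M hM =>
    hmax.eq_top_of_bounded hlam hL (by omega) hg1 hM
  refine ⟨fun hξ r hr => ?_, fun hξ => ?_, fun hξ0 hξα hG => ?_, fun hξα hξ0 => ?_⟩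
  · have hgξ : g ξ = 0 := by
      rcases hξ with hξ | rfl
      · have h1 := hg3.map_eq_zero hgc hξ
        rcases abs_choice ξ with h2 | h2
        · rwa [h2] at h1
        · rw [h2, hg2] at h1
          linarith
      · exact hg2.map_zero
    exact (Sol.unique hlam hL hk.le hg1 h (sol_const hgξ) hr (dom_mono le_top hr)).1
  · have hξ0 : (0 : EReal) < ((|ξ| : ℝ) : EReal) := hg3.1.trans hξ
    have hξ0' : ξ ≠ 0 := abs_pos.mp (by exact_mod_cast hξ0)
    rcases hξ0'.lt_or_gt with hneg | hpos
    · rw [abs_of_neg hneg] at hξ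
      have := (h.neg hg2).strictlyIncreasesToInfty hL hlam hk.le hgc hg3.2.2 hξ
        (by linarith) (by simpa only [abs_neg] using htop)
      simpa only [StrictlyIncreasesToInfty, abs_neg] using this
    · rw [abs_of_pos hpos] at hξ
      exact h.strictlyIncreasesToInfty hlam hL hk.le hgc hg3.2.2 hξ hpos htop
  · obtain ⟨β, hβ0, hβα, hβ⟩ :=
      h.exists_bound_of_pos hlam hLam hk hgc hg2 hg3.2.1 hξ0 hξα hG
    obtain rfl := htop β hβ
    have hub : ∀ r, 0 ≤ r → |u r| ≤ β := fun r hr => hβ r (by rw [dom_top]; exact hr)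
    obtain ⟨ho, h1, h2, h3⟩ := h.oscillating_and_tendsto hlam hL hk hg1 hg2 hg4.1 hg4.2
      hg3.2.1 hβ0 hβα hub
    exact ⟨rfl, ho, h.isLocalized h1 h2 h3, (supNorm_le hβ0 hub).trans_lt hβα⟩
  · have hξα' : ((-ξ : ℝ) : EReal) < α := by
      rw [EReal.coe_neg]
      exact EReal.neg_lt_comm.mp hξα
    have hβ := h.abs_le_of_neg hlam hLam hk hgc hg2 hg3.2.1 hξ0 hξα'
    obtain rfl := htop _ hβ
    have hub : ∀ r, 0 ≤ r → |u r| ≤ -ξ := fun r hr => hβ r (by rw [dom_top]; exact hr)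
    obtain ⟨ho, h1, h2, h3⟩ := h.oscillating_and_tendsto hlam hL hk hg1 hg2 hg4.1 hg4.2
      hg3.2.1 (by linarith) hξα' hub
    refine ⟨rfl, ho, h.isLocalized h1 h2 h3, le_antisymm (supNorm_le (by linarith) hub) ?_, hξα'⟩
    have hc := h.continuousOn_u 0 (zero_mem_dom h.pos)
    rw [dom_top] at hc
    have := abs_le_supNorm hc
    rwa [h.u0, abs_of_neg hξ0] at this
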